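/- Let $q\in\mathbf C$ with $|q|>1$ and $\sigma_q f(z)=f(qz)$. Let $(K,L)$ be one of the following two pairs of fields: $K=\mathcal M(\mathbf C)$ (meromorphic functions on $\mathbf C$) and $L=\mathcal M(\mathbf C^*)$ (meromorphic functions on $\mathbf C^*$); or $K=\mathbf C(\{z\})$ (germs at $0$ of meromorphic functions) and $L=\mathcal M(\mathbf C^*,0)$ (germs at $0$ of functions meromorphic on a punctured disc around $0$). Let $v_0$ be the $z$-adic valuation on $K$ and let $C_L=\{c\in L:\sigma_q c=c\}$ be the field of constants of $L$. Consider the $q$-difference equation $$(1)\qquad P.f:=a_0\,\sigma_q^n f+a_1\,\sigma_q^{n-1}f+\cdots+a_n f=0,\qquad a_0,\dots,a_n\in K,\quad a_0a_n\neq 0 .$$ Its Newton polygon $N(P)$ is the convex hull in $\mathbf R^2$ of $\{(i,j)\in\mathbf Z^2: 0\le i\le n,\ j\ge v_0(a_i)\}$. The boundary of $N(P)$ consists of two vertical half-lines and of finitely many vectors $(r_1,d_1),\dots,(r_k,d_k)\in\mathbf N^*\times\mathbf Z$ with pairwise distinct slopes $d_i/r_i$, numbered so that $\mu_1>\cdots>\mu_k$,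 where $\mu_i=d_i/r_i$; put $r_P(\mu_i)=r_i$. Put $\theta_q(z)=\sum_{m\in\mathbf Z}(-1)^m q^{-m(m-1)/2}z^m$, $\Theta_q(z)=\theta_q(-z/q)$, $l_q(z)=z\theta_q'(z)/\theta_q(z)$, and, for $c\in\mathbf C^*$ and $\mu\in\mathbf Z$, $e_{q,c}(z)=\theta_q(z)/\theta_q(c^{-1}z)$ and $e_{q,cz^\mu}=e_{q,c}\,\Theta_q^{\mu}$. Let $S=K\big[(e_{q,cz^\mu})_{(c,\mu)\in\mathbf C^*\times\mathbf Z},\,l_q\big]\subset L$ be the $K$-subalgebra generated by these functions. **Théorème A.4.1 (lemme d'Adams).** Suppose that the first (that is, smallest) slope $\mu_k$ of $P$ is an integer. Then equation (1) has $r_P(\mu_k)$ solutions in $S$ (convergent solutions, built from uniform functions on $\mathbf C^*$) that are linearly independent over the field of constants $C_L$. -/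

import Mathlib

open Filter Topology

namespace QDiff

noncomputable section

/-! ### Germs at the origin of functions on the punctured plane -/

/-- The filter along which germs are taken: a set belongs to it iff every point `z ≠ 0` close
enough to `0` has a punctured neighbourhood contained in the set.  Thus two functions are
identified iff, on some punctured disc around `0`, they agree away from a discrete set (closed in
the punctured disc).  This is the usual identification of meromorphic functions. -/
def originFilter : Filter ℂ := (𝓝[≠] (0 : ℂ)).bind fun z => 𝓝[≠] z

theorem mem_originFilter {s : Set ℂ} :
    s ∈ originFilter ↔ ∀ᶠ z in 𝓝[≠] (0 : ℂ), s ∈ 𝓝[≠] z := Iff.rfl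

/-- The commutative ring of germs at `0`, in which all the fields below live. -/
abbrev OriginGerm : Type := Germ originFilter ℂ

/-- The identity theorem: a meromorphic function on `ℂ ∖ {0}` is determined by its germ, so that
the field of meromorphic functions on `ℂ ∖ {0}` is a subring of `OriginGerm`. -/
theorem coe_eq_coe_iff {f g : ℂ → ℂ} (hf : MeromorphicOn f {0}ᶜ) (hg : MeromorphicOn g {0}ᶜ) :
    ((f : OriginGerm) = (g : OriginGerm)) ↔ f =ᶠ[codiscreteWithin {0}ᶜ] g := by
  have hconn : IsPreconnected ({0}ᶜ : Set ℂ) :=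
    (isConnected_compl_singleton_of_one_lt_rank (by simp) (0 : ℂ)).isPreconnected
  rw [Germ.coe_eq]
  constructor
  · intro h
    have h' : ∀ᶠ z in 𝓝[≠] (0 : ℂ), ∀ᶠ w in 𝓝[≠] z, f w = g w := h
    obtain ⟨z, hz, hz0⟩ := (h'.and eventually_mem_nhdsWithin).exists
    have hd : MeromorphicOn (f - g) {0}ᶜ := hf.sub hg
    have htop : ∀ w ∈ ({0}ᶜ : Set ℂ), meromorphicOrderAt (f - g) w = ⊤ := by
      intro w hw
      by_contra hne
      refine hd.meromorphicOrderAt_ne_top_of_isPreconnected hconn hw hz0 hne ?_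
      rw [meromorphicOrderAt_eq_top_iff]
      filter_upwards [hz] with w hw using by simp [hw]
    refine mem_codiscreteWithin_iff_forall_mem_nhdsNE.2 fun w hw => ?_
    filter_upwards [meromorphicOrderAt_eq_top_iff.1 (htop w hw)] with x hx
    exact Or.inl (sub_eq_zero.1 hx)
  · intro h
    change ∀ᶠ z in 𝓝[≠] (0 : ℂ), ∀ᶠ w in 𝓝[≠] z, f w = g w
    filter_upwards [eventually_mem_nhdsWithin] with z hz
    have h1 := mem_codiscreteWithin_iff_forall_mem_nhdsNE.1 h z hz
    have h2 : ({0}ᶜ : Set ℂ) ∈ 𝓝[≠] z :=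
      mem_nhdsWithin_of_mem_nhds (isOpen_compl_singleton.mem_nhds hz)
    filter_upwards [h1, h2] with w hw hw0
    exact hw.resolve_right fun h => h hw0

/-! ### The two convergent situations -/

/-- The germs represented by a function that is meromorphic at every point of some set belonging
to the filter `F`. -/
def meromorphicGerms (F : Filter ℂ) : Subring OriginGerm where
  carrier := {g | ∃ f : ℂ → ℂ, (∀ᶠ z in F, MeromorphicAt f z) ∧ (f : OriginGerm) = g}
  zero_mem' := ⟨0, Eventually.of_forall fun z => MeromorphicAt.const 0 z, rfl⟩
  one_mem' := ⟨1, Eventually.of_forall fun z => MeromorphicAt.const 1 z, rfl⟩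
  add_mem' := by
    rintro _ _ ⟨f, hf, rfl⟩ ⟨g, hg, rfl⟩
    exact ⟨f + g, (hf.and hg).mono fun z h => h.1.add h.2, rfl⟩
  mul_mem' := by
    rintro _ _ ⟨f, hf, rfl⟩ ⟨g, hg, rfl⟩
    exact ⟨f * g, (hf.and hg).mono fun z h => h.1.mul h.2, rfl⟩
  neg_mem' := by
    rintro _ ⟨f, hf, rfl⟩
    exact ⟨-f, hf.mono fun z h => h.neg, rfl⟩

/-- The two cases of the convergent theory: coefficients meromorphic on the whole plane, or germs
at `0` of meromorphic functions. -/
inductive ConvergentCase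
  | entire
  | germ

namespace ConvergentCase

/-- The base field `K`: the field `ℳ(ℂ)` of meromorphic functions on `ℂ`, or the field `ℂ({z})`
of germs at `0` of meromorphic functions (convergent Laurent series). -/
def K : ConvergentCase → Subring OriginGerm
  | entire => meromorphicGerms (𝓟 Set.univ)
  | germ => meromorphicGerms (𝓝 0)

/-- The field `L` in which solutions are sought: the field `ℳ(ℂ*)` of meromorphic functions on
`ℂ ∖ {0}`, or the field `ℳ(ℂ*, 0)` of germs at `0` of meromorphic functions on punctured discs. -/
def L : ConvergentCase → Subring OriginGerm
  | entire => meromorphicGerms (𝓟 {0}ᶜ)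
  | germ => meromorphicGerms (𝓝[≠] 0)

theorem K_le_germ_K (C : ConvergentCase) : C.K ≤ germ.K := by
  cases C
  · rintro _ ⟨f, hf, rfl⟩
    exact ⟨f, hf.filter_mono (by simp), rfl⟩
  · exact le_rfl

end ConvergentCase

open Classical in
/-- The `z`-adic valuation `v₀` (with `v₀ 0 = ⊤`), for germs of functions meromorphic at `0`. -/
def v₀ (g : OriginGerm) : WithTop ℤ :=
  if h : ∃ f : ℂ → ℂ, MeromorphicAt f 0 ∧ (f : OriginGerm) = g then
    meromorphicOrderAt h.choose 0 else 0

theorem eventuallyEq_of_coe_eq {f g : ℂ → ℂ} (hf : MeromorphicAt f 0) (hg : MeromorphicAt g 0)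
    (h : (f : OriginGerm) = g) : f =ᶠ[𝓝[≠] 0] g := by
  have h' : ∀ᶠ z in 𝓝[≠] (0 : ℂ), ∀ᶠ w in 𝓝[≠] z, f w = g w := Germ.coe_eq.1 h
  rcases (hf.sub hg).eventually_eq_zero_or_eventually_ne_zero with h0 | h0
  · exact h0.mono fun z hz => sub_eq_zero.1 hz
  · have h1 : ∀ᶠ z in 𝓝[≠] (0 : ℂ), ∀ᶠ w in 𝓝[≠] z, (f - g) w ≠ 0 := by
      filter_upwards [eventually_eventually_nhdsWithin.2 h0, eventually_mem_nhdsWithin]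
        with z hz hz0
      have h3 : ∀ᶠ w in 𝓝 z, (f - g) w ≠ 0 := by
        rwa [isOpen_compl_singleton.nhdsWithin_eq hz0] at hz
      exact h3.filter_mono nhdsWithin_le_nhds
    obtain ⟨z, hz, hz'⟩ := (h'.and h1).exists
    obtain ⟨w, hw, hw'⟩ := (hz.and hz').exists
    exact absurd (by simp [hw]) hw'

/-- On a germ represented by a function meromorphic at `0`, the valuation is the order at `0`. -/
theorem v₀_coe {f : ℂ → ℂ} (hf : MeromorphicAt f 0) :
    v₀ (f : OriginGerm) = meromorphicOrderAt f 0 := by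
  have h : ∃ g : ℂ → ℂ, MeromorphicAt g 0 ∧ (g : OriginGerm) = f := ⟨f, hf, rfl⟩
  rw [v₀, dif_pos h]
  exact meromorphicOrderAt_congr
    (eventuallyEq_of_coe_eq h.choose_spec.1 hf h.choose_spec.2)

/-! ### The operator `σ_q` and the constants -/

theorem tendsto_mul_originFilter {q : ℂ} (hq : 1 < ‖q‖) :
    Tendsto (fun z => q * z) originFilter originFilter := by
  have hq0 : q ≠ 0 := norm_pos_iff.1 (one_pos.trans hq)
  have h : ∀ z : ℂ, Tendsto (fun w => q * w) (𝓝[≠] z) (𝓝[≠] (q * z)) := fun z =>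
    tendsto_nhdsWithin_of_tendsto_nhds_of_eventually_within _
      ((continuous_const_mul q).continuousAt.mono_left nhdsWithin_le_nhds)
      (eventually_mem_nhdsWithin.mono fun w hw h => hw (mul_left_cancel₀ hq0 h))
  intro s hs
  have h0 := h 0
  rw [mul_zero] at h0
  exact (h0.eventually hs).mono fun z hz => h z hz

/-- The automorphism `σ_q : f(z) ↦ f(qz)`. -/
def sigma (q : ℂ) (hq : 1 < ‖q‖) : OriginGerm →+* OriginGerm where
  toFun g := g.compTendsto (fun z => q * z) (tendsto_mul_originFilter hq)
  map_zero' := rfl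
  map_one' := rfl
  map_add' f g := by
    induction f using Germ.inductionOn
    induction g using Germ.inductionOn
    rfl
  map_mul' f g := by
    induction f using Germ.inductionOn
    induction g using Germ.inductionOn
    rfl

theorem sigma_coe (q : ℂ) (hq : 1 < ‖q‖) (f : ℂ → ℂ) :
    sigma q hq (f : OriginGerm) = ((fun z => f (q * z) : ℂ → ℂ) : OriginGerm) := rfl

/-- The constants of `L`: the elements of `L` invariant under `σ_q` (these are the elliptic
functions, i.e. the meromorphic functions on `ℂ* / q^ℤ`). -/
def constants (q : ℂ) (hq : 1 < ‖q‖) (C : ConvergentCase) : Subring OriginGerm :=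
  C.L ⊓ (sigma q hq).eqLocus (RingHom.id OriginGerm)

/-! ### Elementary uniform functions on `ℂ*` -/

/-- `θ_q(z) = ∑_{n ∈ ℤ} (-1)^n q^{-n(n-1)/2} z^n` (absolutely convergent for `|q| > 1`, `z ≠ 0`). -/
def theta (q z : ℂ) : ℂ :=
  ∑' n : ℤ, (-1) ^ n * q ^ (-(n * (n - 1) / 2)) * z ^ n

/-- The Jacobi Theta function `Θ_q(z) = θ_q(-z/q)`, which satisfies `Θ_q(qz) = z Θ_q(z)`. -/
def bigTheta (q z : ℂ) : ℂ := theta q (-z / q)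

/-- The `q`-logarithm `l_q(z) = z θ_q'(z) / θ_q(z)`, which satisfies `l_q(qz) = l_q(z) + 1`. -/
def qLog (q z : ℂ) : ℂ := z * deriv (theta q) z / theta q z

/-- The `q`-character `e_{q,c}(z) = θ_q(z) / θ_q(z/c)`, which satisfies
`e_{q,c}(qz) = c e_{q,c}(z)`. -/
def qChar (q c z : ℂ) : ℂ := theta q z / theta q (c⁻¹ * z)

/-- `e_{q, c z^μ} = e_{q,c} Θ_q^μ`, which satisfies `f(qz) = c z^μ f(z)`. -/
def qCharMonomial (q c : ℂ) (μ : ℤ) (z : ℂ) : ℂ := qChar q c z * bigTheta q z ^ μ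

/-- The `K`-algebra `S = K[(e_{q, c z^μ})_{(c, μ) ∈ ℂ* × ℤ}, l_q]` of convergent expressions. -/
def convergentAlgebra (q : ℂ) (C : ConvergentCase) : Subalgebra C.K OriginGerm :=
  Algebra.adjoin C.K
    ({g | ∃ (c : ℂ) (μ : ℤ), c ≠ 0 ∧ g = (qCharMonomial q c μ : OriginGerm)} ∪
      {(qLog q : OriginGerm)})

/-! ### `q`-difference equations and their Newton polygon -/

/-- `P.f = a₀ σ_q^n f + a₁ σ_q^{n-1} f + ⋯ + a_n f`. -/
def applyOp (q : ℂ) (hq : 1 < ‖q‖) {n : ℕ} (a : Fin (n + 1) → OriginGerm) (f : OriginGerm) :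
    OriginGerm :=
  ∑ i : Fin (n + 1), a i * (sigma q hq)^[n - (i : ℕ)] f

/-- The Newton polygon `N(P)`: the convex hull in `ℝ²` of the integral points `(i, j)` such that
`j ≥ v₀(a_i)`, where `a_i` is the coefficient of `σ^{n-i}`. -/
def newtonPolygon {n : ℕ} (a : Fin (n + 1) → OriginGerm) : Set (ℝ × ℝ) :=
  convexHull ℝ {p | ∃ (i : Fin (n + 1)) (j : ℤ),
    v₀ (a i) ≤ (j : WithTop ℤ) ∧ p = (((i : ℕ) : ℝ), (j : ℝ))}

/-- The set of points of `N` lying on its supporting line of slope `μ` (from below): the edge of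
slope `μ` if `μ` is a slope, and a single vertex otherwise. -/
def lowerFace (N : Set (ℝ × ℝ)) (μ : ℚ) : Set (ℝ × ℝ) :=
  {p ∈ N | ∀ p' ∈ N, p.2 - (μ : ℝ) * p.1 ≤ p'.2 - (μ : ℝ) * p'.1}

/-- The Newton function `r_P : ℚ → ℕ`: `r_P(μ)` is the horizontal length `r` of the boundary
vector `(r, d)` of `N(P)` of slope `d / r = μ`, and `0` if there is none.  (The vertices of `N(P)`
are integral points, so this length is a natural number and taking the integer part does not
alter it.) -/
def newtonFunction {n : ℕ} (a : Fin (n + 1) → OriginGerm) (μ : ℚ) : ℕ :=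
  ⌊Metric.diam (Prod.fst '' lowerFace (newtonPolygon a) μ)⌋₊

/-- The set `S(P)` of slopes. -/
def slopes {n : ℕ} (a : Fin (n + 1) → OriginGerm) : Set ℚ := {μ | newtonFunction a μ ≠ 0}

end

end QDiff

namespace QDiff

noncomputable section

/-! ### Germs: basic facts -/

/-! Put `r = r_P(μ)`. The polygon lies above the line through its first edge, so `a_i = z^(d+μi)
b_i` with `b_i` analytic at `0`, `b_0` and `b_r` nonzero at `0`, and `b_i` zero at `0` for `i > r`
(`exists_first_edge`, `exists_eq_zmon_mul_of_le`). Since `σ_q^j Θ_q^μ` is a constant times `z^(μj)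
Θ_q^μ`, substituting `f = Θ_q^μ g` clears the powers of `z` (`exists_gauge_transform`). What remains
is an operator `p` whose coefficients at `0` form a polynomial `X^(n-r) χ`, with `deg χ = r` and
`χ(0) ≠ 0`. Polynomials over `analyticGerms` only record coefficients: composition of operators is
twisted by `σ_q`, and becomes multiplication of polynomials only after evaluation at `0`.

`exists_independent_solutions` argues by induction on `r`. Let `c` be a root of `χ` of largest
modulus, so that no `c q^m` with `m ≥ 1` is a root. Conjugation by `e_{q,c}` moves `c` to `1`, and
the coefficients of a series solution `u = 1 + ...` are determined recursively. The series converges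
because the leading coefficient of `p` is nonzero at `0`: the divisor at order `m` is the
characteristic polynomial at `q^m`, of the full size `|q|^(mn)`, and dominates the other terms
(`exists_skewEval_eq`). When the coefficients are meromorphic on the plane, the equation itself
continues `u` to the plane (`exists_meromorphic_extension`).

With `a = c σ_q(u)/u`, the solution `e_{q,c} u` is killed by `σ_q - a`, so `p = p' (σ_q - a)`
(`exists_right_division`), and `p'` has `r - 1` nonzero exponents. Its solutions are lifted through
`σ_q - a`, which is surjective on combinations of `q`-characters times polynomials in `l_q`
(`exists_sigma_sub_eq`); the `q`-logarithm absorbs the resonances. -/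

theorem originFilter_le : originFilter ≤ 𝓝[≠] (0 : ℂ) := by
  intro s hs
  rw [mem_originFilter]
  filter_upwards [eventually_eventually_nhdsWithin.2 hs, eventually_mem_nhdsWithin] with z hz hz0
  have h3 : s ∈ 𝓝 z := by
    have : s ∈ 𝓝[{0}ᶜ] z := hz
    rwa [isOpen_compl_singleton.nhdsWithin_eq hz0] at this
  exact mem_nhdsWithin_of_mem_nhds h3

theorem coe_eq_of_eventually {f g : ℂ → ℂ} (h : ∀ᶠ z in 𝓝[≠] (0 : ℂ), f z = g z) :
    (f : OriginGerm) = g :=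
  Germ.coe_eq.2 (originFilter_le h)

theorem coe_eq_of_forall_ne {f g : ℂ → ℂ} (h : ∀ z ≠ 0, f z = g z) : (f : OriginGerm) = g :=
  coe_eq_of_eventually (eventually_mem_nhdsWithin.mono h)

/-- The constant germs. -/
def constGerm : ℂ →+* OriginGerm where
  toFun c := ((fun _ => c : ℂ → ℂ) : OriginGerm)
  map_zero' := rfl
  map_one' := rfl
  map_add' _ _ := rfl
  map_mul' _ _ := rfl

/-- The germ of `z ↦ z ^ m`. -/
def zmon (m : ℤ) : OriginGerm := ((fun z => z ^ m : ℂ → ℂ) : OriginGerm)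

theorem zmon_add (m k : ℤ) : zmon (m + k) = zmon m * zmon k :=
  coe_eq_of_forall_ne fun z hz => by simp [zpow_add₀ hz]

@[simp] theorem zmon_zero : zmon 0 = 1 := coe_eq_of_forall_ne fun z _ => by simp

theorem zmon_mul_neg (m : ℤ) : zmon m * zmon (-m) = 1 := by rw [← zmon_add]; simp

/-- `OriginGerm` is not a field, and the pointwise inverse takes the value `0` at zeros. A
representative of a unit is nonzero along the filter, where the pointwise inverse is a true one. -/
theorem mul_inv_of_isUnit {x : OriginGerm} (hx : IsUnit x) : x * x⁻¹ = 1 := by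
  obtain ⟨y, hy⟩ := hx.exists_right_inv
  induction x using Germ.inductionOn with | _ f =>
  induction y using Germ.inductionOn with | _ g =>
  have h : ∀ᶠ z in originFilter, f z * g z = 1 := Germ.coe_eq.1 hy
  refine Germ.coe_eq.2 (h.mono fun z hz => ?_)
  exact mul_inv_cancel₀ (left_ne_zero_of_mul (hz ▸ one_ne_zero : f z * g z ≠ 0))

theorem isUnit_coe {f : ℂ → ℂ} (h : ∀ᶠ z in originFilter, f z ≠ 0) : IsUnit (f : OriginGerm) :=
  IsUnit.of_mul_eq_one ((f⁻¹ : ℂ → ℂ) : OriginGerm)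
    (Germ.coe_eq.2 (h.mono fun _ hz => mul_inv_cancel₀ hz))

/-! ### The operator `σ_q` -/

variable (q : ℂ) (hq : 1 < ‖q‖)

theorem q_ne_zero {q : ℂ} (hq : 1 < ‖q‖) : q ≠ 0 := norm_pos_iff.1 (one_pos.trans hq)

theorem sigma_iterate_coe (f : ℂ → ℂ) (j : ℕ) :
    (sigma q hq)^[j] (f : OriginGerm) = ((fun z => f (q ^ j * z) : ℂ → ℂ) : OriginGerm) := by
  induction j generalizing f with
  | zero => simp
  | succ j ih =>
    rw [Function.iterate_succ_apply, sigma_coe, ih]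
    simp only [pow_succ', mul_assoc]

@[simp] theorem sigma_constGerm (c : ℂ) : sigma q hq (constGerm c) = constGerm c := rfl

theorem sigma_zmon (m : ℤ) : sigma q hq (zmon m) = constGerm (q ^ m) * zmon m := by
  change (((fun z => (q * z) ^ m : ℂ → ℂ) : OriginGerm)) = _
  exact coe_eq_of_forall_ne fun z _ => by simp [mul_zpow]

theorem sigma_mem_K {x : OriginGerm} (C : ConvergentCase) (hx : x ∈ C.K) :
    sigma q hq x ∈ C.K := by
  have key : ∀ (f : ℂ → ℂ) (z : ℂ), MeromorphicAt f (q * z) →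
      MeromorphicAt (fun w => f (q * w)) z := fun f z h => by
    have h2 : AnalyticAt ℂ (fun w => q * w) z := by fun_prop
    exact h.comp_analyticAt h2
  cases C
  · obtain ⟨f, hf, rfl⟩ := hx
    refine ⟨fun z => f (q * z), ?_, rfl⟩
    rw [eventually_principal] at hf ⊢
    exact fun z _ => key f z (hf _ trivial)
  · obtain ⟨f, hf, rfl⟩ := hx
    refine ⟨fun z => f (q * z), ?_, rfl⟩
    have : Tendsto (fun z : ℂ => q * z) (𝓝 0) (𝓝 0) := by
      simpa using (continuous_const_mul q).tendsto 0
    exact (this.eventually hf).mono fun z => key f z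

theorem inv_mem_meromorphicGerms {F : Filter ℂ} {x : OriginGerm} (hx : x ∈ meromorphicGerms F) :
    x⁻¹ ∈ meromorphicGerms F := by
  obtain ⟨f, hf, rfl⟩ := hx
  exact ⟨f⁻¹, hf.mono fun z h => h.inv, rfl⟩

theorem inv_mem_K {C : ConvergentCase} {x : OriginGerm} (hx : x ∈ C.K) : x⁻¹ ∈ C.K := by
  cases C <;> exact inv_mem_meromorphicGerms hx

theorem K_le_L (C : ConvergentCase) : C.K ≤ C.L := by
  cases C
  · rintro _ ⟨f, hf, rfl⟩
    exact ⟨f, hf.filter_mono (by simp), rfl⟩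
  · rintro _ ⟨f, hf, rfl⟩
    exact ⟨f, hf.filter_mono nhdsWithin_le_nhds, rfl⟩

theorem coe_mem_K {f : ℂ → ℂ} (hf : ∀ z, MeromorphicAt f z) (C : ConvergentCase) :
    (f : OriginGerm) ∈ C.K := by
  cases C <;> exact ⟨f, Eventually.of_forall hf, rfl⟩

theorem coe_mem_L {f : ℂ → ℂ} (hf : ∀ z ≠ 0, MeromorphicAt f z) (C : ConvergentCase) :
    (f : OriginGerm) ∈ C.L := by
  cases C
  · exact ⟨f, by simpa using hf, rfl⟩
  · exact ⟨f, eventually_mem_nhdsWithin.mono hf, rfl⟩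

theorem constGerm_mem_K (c : ℂ) (C : ConvergentCase) : constGerm c ∈ C.K :=
  coe_mem_K (fun z => MeromorphicAt.const c z) C

theorem zmon_mem_K (m : ℤ) (C : ConvergentCase) : zmon m ∈ C.K :=
  coe_mem_K (fun z => (MeromorphicAt.id z).zpow m) C

theorem exists_rep_of_mem_germK {x : OriginGerm} (hx : x ∈ ConvergentCase.germ.K) :
    ∃ f : ℂ → ℂ, MeromorphicAt f 0 ∧ (f : OriginGerm) = x := by
  obtain ⟨f, hf, rfl⟩ := hx
  exact ⟨f, hf.self_of_nhds, rfl⟩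

/-- Meromorphy at the single point `0` forces analyticity at all nearby nonzero points, hence
meromorphy on a full neighbourhood. -/
theorem coe_mem_germK {f : ℂ → ℂ} (hf : MeromorphicAt f 0) :
    (f : OriginGerm) ∈ ConvergentCase.germ.K := by
  refine ⟨f, ?_, rfl⟩
  have h := hf.eventually_analyticAt
  rw [eventually_nhdsWithin_iff] at h
  filter_upwards [h] with z hz
  by_cases h0 : z = 0
  · rwa [h0]
  · exact (hz h0).meromorphicAt

theorem eventually_ne_zero_of_coe_ne_zero {f : ℂ → ℂ} (hf : MeromorphicAt f 0)
    (h : (f : OriginGerm) ≠ 0) : ∀ᶠ z in 𝓝[≠] (0 : ℂ), f z ≠ 0 :=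
  hf.eventually_eq_zero_or_eventually_ne_zero.resolve_left fun h0 =>
    h (coe_eq_of_eventually h0)

/-! ### Germs analytic at the origin -/

/-- The ring of germs analytic at `0`. -/
def analyticGerms : Subring OriginGerm where
  carrier := {g | ∃ f : ℂ → ℂ, AnalyticAt ℂ f 0 ∧ (f : OriginGerm) = g}
  zero_mem' := ⟨0, analyticAt_const, rfl⟩
  one_mem' := ⟨1, analyticAt_const, rfl⟩
  add_mem' := by
    rintro _ _ ⟨f, hf, rfl⟩ ⟨g, hg, rfl⟩
    exact ⟨f + g, hf.add hg, rfl⟩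
  mul_mem' := by
    rintro _ _ ⟨f, hf, rfl⟩ ⟨g, hg, rfl⟩
    exact ⟨f * g, hf.mul hg, rfl⟩
  neg_mem' := by
    rintro _ ⟨f, hf, rfl⟩
    exact ⟨-f, hf.neg, rfl⟩

/-- The germ in `analyticGerms` of an analytic function. -/
def analyticGerm (f : ℂ → ℂ) (hf : AnalyticAt ℂ f 0) : analyticGerms := ⟨(f : OriginGerm), f, hf, rfl⟩

theorem exists_analyticGerm_eq (x : analyticGerms) : ∃ f hf, analyticGerm f hf = x := by
  obtain ⟨_, f, hf, rfl⟩ := x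
  exact ⟨f, hf, rfl⟩

theorem apply_zero_eq_of_coe_eq {f g : ℂ → ℂ} (hf : AnalyticAt ℂ f 0) (hg : AnalyticAt ℂ g 0)
    (h : (f : OriginGerm) = g) : f 0 = g 0 := by
  have h1 := eventuallyEq_of_coe_eq hf.meromorphicAt hg.meromorphicAt h
  have h2 := (hf.continuousAt.eventuallyEq_nhds_iff_eventuallyEq_nhdsNE hg.continuousAt).1 h1
  exact h2.eq_of_nhds

theorem value_eq {x : analyticGerms} {f : ℂ → ℂ} (hf : AnalyticAt ℂ f 0)
    (h : (f : OriginGerm) = x) : x.2.choose 0 = f 0 :=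
  apply_zero_eq_of_coe_eq x.2.choose_spec.1 hf (x.2.choose_spec.2.trans h.symm)

/-- The value at `0`. -/
def residue : analyticGerms →+* ℂ where
  toFun x := x.2.choose 0
  map_zero' := value_eq (f := 0) analyticAt_const rfl
  map_one' := value_eq (f := 1) analyticAt_const rfl
  map_add' x y := value_eq (f := x.2.choose + y.2.choose)
    (x.2.choose_spec.1.add y.2.choose_spec.1) (by
      rw [Germ.coe_add, x.2.choose_spec.2, y.2.choose_spec.2]; rfl)
  map_mul' x y := value_eq (f := x.2.choose * y.2.choose)
    (x.2.choose_spec.1.mul y.2.choose_spec.1) (by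
      rw [Germ.coe_mul, x.2.choose_spec.2, y.2.choose_spec.2]; rfl)

@[simp] theorem residue_analyticGerm (f : ℂ → ℂ) (hf : AnalyticAt ℂ f 0) :
    residue (analyticGerm f hf) = f 0 :=
  value_eq hf rfl

/-- The constants, as germs analytic at `0`. -/
def constAnalytic : ℂ →+* analyticGerms :=
  constGerm.codRestrict analyticGerms fun c => ⟨fun _ => c, analyticAt_const, rfl⟩

@[simp] theorem coe_constAnalytic (c : ℂ) : (constAnalytic c : OriginGerm) = constGerm c := rfl

@[simp] theorem residue_constAnalytic (c : ℂ) : residue (constAnalytic c) = c :=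
  residue_analyticGerm (fun _ => c) analyticAt_const

theorem analyticGerms_le_germK : analyticGerms ≤ ConvergentCase.germ.K := by
  rintro _ ⟨f, hf, rfl⟩
  exact coe_mem_germK hf.meromorphicAt

theorem isUnit_of_residue_ne_zero {x : analyticGerms} (hx : residue x ≠ 0) : IsUnit x := by
  obtain ⟨f, hf, rfl⟩ := exists_analyticGerm_eq x
  rw [residue_analyticGerm] at hx
  refine IsUnit.of_mul_eq_one (analyticGerm f⁻¹ (hf.inv hx)) (Subtype.ext ?_)
  refine coe_eq_of_eventually (f := f * f⁻¹) (g := 1) ?_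
  have := hf.continuousAt.eventually_ne hx
  exact (this.filter_mono nhdsWithin_le_nhds).mono fun z hz => mul_inv_cancel₀ hz

/-- `σ_q` on germs analytic at `0`. -/
def sigmaAnalytic : analyticGerms →+* analyticGerms :=
  ((sigma q hq).comp analyticGerms.subtype).codRestrict analyticGerms fun x => by
    obtain ⟨f, hf, rfl⟩ := exists_analyticGerm_eq x
    refine ⟨fun z => f (q * z), ?_, rfl⟩
    have h2 : AnalyticAt ℂ (fun w => q * w) 0 := by fun_prop
    exact AnalyticAt.comp (by simpa using hf) h2

@[simp] theorem residue_sigmaAnalytic (x : analyticGerms) :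
    residue (sigmaAnalytic q hq x) = residue x := by
  obtain ⟨f, hf, rfl⟩ := exists_analyticGerm_eq x
  have h2 : AnalyticAt ℂ (fun w => q * w) 0 := by fun_prop
  have h3 : AnalyticAt ℂ (fun z => f (q * z)) 0 := AnalyticAt.comp (by simpa using hf) h2
  change residue (analyticGerm (fun z => f (q * z)) h3) = _
  simp

/-- A germ analytic and vanishing at `0` is divisible by `z`. -/
theorem exists_eq_zmon_one_mul {x : analyticGerms} (hx : residue x = 0) :
    ∃ y : analyticGerms, (x : OriginGerm) = zmon 1 * y := by
  obtain ⟨f, hf, rfl⟩ := exists_analyticGerm_eq x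
  rw [residue_analyticGerm] at hx
  have hd : AnalyticAt ℂ (dslope f 0) 0 := by
    obtain ⟨p, hp⟩ := hf
    exact ⟨_, hp.has_fpower_series_dslope_fslope⟩
  refine ⟨analyticGerm _ hd, ?_⟩
  refine coe_eq_of_forall_ne fun z hz => ?_
  have h := sub_smul_dslope f 0 z
  rw [hx] at h
  simpa [smul_eq_mul] using h.symm

/-- Germs of meromorphic functions are of the form `z ^ m` times an analytic germ. -/
theorem exists_eq_zmon_mul {x : OriginGerm} (hx : x ∈ ConvergentCase.germ.K) :
    ∃ (m : ℤ) (y : analyticGerms), x = zmon m * y := by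
  obtain ⟨f, hf, rfl⟩ := exists_rep_of_mem_germK hx
  obtain ⟨m, g, hg, h⟩ := MeromorphicAt.iff_eventuallyEq_zpow_smul_analyticAt.1 hf
  exact ⟨m, analyticGerm g hg, coe_eq_of_eventually (by simpa [smul_eq_mul] using h)⟩

/-! ### `q`-difference operators -/

open Polynomial

/-- The value at `f` of the operator `∑ p_j σ_q^j`. -/
def skewEval (p : analyticGerms[X]) (f : OriginGerm) : OriginGerm :=
  p.sum fun j b => (b : OriginGerm) * (sigma q hq)^[j] f

theorem skewEval_add (p r : analyticGerms[X]) (f : OriginGerm) :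
    skewEval q hq (p + r) f = skewEval q hq p f + skewEval q hq r f :=
  Polynomial.sum_add_index _ _ _ (fun i => by simp) fun i a b => by simp [add_mul]

@[simp] theorem skewEval_zero (f : OriginGerm) : skewEval q hq 0 f = 0 := by simp [skewEval]

theorem skewEval_monomial (j : ℕ) (b : analyticGerms) (f : OriginGerm) :
    skewEval q hq (monomial j b) f = b * (sigma q hq)^[j] f :=
  Polynomial.sum_monomial_index _ _ (by simp)

theorem skewEval_sum {ι : Type*} (s : Finset ι) (p : ι → analyticGerms[X]) (f : OriginGerm) :
    skewEval q hq (∑ i ∈ s, p i) f = ∑ i ∈ s, skewEval q hq (p i) f := by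
  classical
  induction s using Finset.induction_on with
  | empty => simp
  | insert i s hi ih => rw [Finset.sum_insert hi, Finset.sum_insert hi, skewEval_add, ih]

theorem skewEval_eq_sum_range {p : analyticGerms[X]} {n : ℕ} (hp : p.natDegree ≤ n)
    (f : OriginGerm) :
    skewEval q hq p f = ∑ j ∈ Finset.range (n + 1), (p.coeff j : OriginGerm) * (sigma q hq)^[j] f :=
  Polynomial.sum_over_range' _ (fun i => by simp) _ (Nat.lt_succ_of_le hp)

theorem coe_sum {ι : Type*} (s : Finset ι) (f : ι → ℂ → ℂ) :
    ((fun z => ∑ i ∈ s, f i z : ℂ → ℂ) : OriginGerm) = ∑ i ∈ s, (f i : OriginGerm) := by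
  classical
  induction s using Finset.induction_on with
  | empty => simp only [Finset.sum_empty]; rfl
  | insert i s hi ih => simp only [Finset.sum_insert hi, ← ih]; rfl

theorem skewEval_coe {p : analyticGerms[X]} {n : ℕ} (hp : p.natDegree ≤ n) {f : ℕ → ℂ → ℂ}
    (hf : ∀ j, (f j : OriginGerm) = p.coeff j) (U : ℂ → ℂ) :
    skewEval q hq p (U : OriginGerm) =
      ((fun z => ∑ j ∈ Finset.range (n + 1), f j z * U (q ^ j * z) : ℂ → ℂ) : OriginGerm) := by
  rw [skewEval_eq_sum_range q hq hp, coe_sum]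
  refine Finset.sum_congr rfl fun j _ => ?_
  rw [← hf, sigma_iterate_coe]
  rfl

theorem skewEval_map_add (p : analyticGerms[X]) (f g : OriginGerm) :
    skewEval q hq p (f + g) = skewEval q hq p f + skewEval q hq p g := by
  simp only [skewEval, Polynomial.sum, iterate_map_add, mul_add, Finset.sum_add_distrib]

/-- Conjugating an operator by an eigenvector of `σ_q` rescales its symbol. -/
theorem skewEval_mul {c : ℂ} {e : OriginGerm} (he : sigma q hq e = constGerm c * e)
    (p : analyticGerms[X]) (f : OriginGerm) :
    skewEval q hq p (e * f) = e * skewEval q hq (p.comp (C (constAnalytic c) * X)) f := by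
  have hit : ∀ j : ℕ, (sigma q hq)^[j] e = constGerm c ^ j * e := fun j => by
    induction j with
    | zero => simp
    | succ j ih => rw [Function.iterate_succ_apply', ih, map_mul, map_pow, he, sigma_constGerm]; ring
  induction p using Polynomial.induction_on' with
  | add p r hp hr => rw [skewEval_add, hp, hr, add_comp, skewEval_add, mul_add]
  | monomial j b =>
    have h : (monomial j b).comp (C (constAnalytic c) * X) = monomial j (b * constAnalytic c ^ j) := by
      rw [monomial_comp, mul_pow, ← C_pow, ← mul_assoc, ← C_mul, C_mul_X_pow_eq_monomial]
    rw [h, skewEval_monomial, skewEval_monomial, iterate_map_mul, hit]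
    push_cast
    rw [coe_constAnalytic]
    ring

theorem skewEval_one (p : analyticGerms[X]) :
    skewEval q hq p 1 = (p.eval 1 : analyticGerms) := by
  simp [skewEval, Polynomial.eval_eq_sum, Polynomial.sum, iterate_map_one]

theorem residue_eval (p : analyticGerms[X]) (c : ℂ) :
    residue (p.eval (constAnalytic c)) = (p.map residue).eval c := by
  rw [Polynomial.eval_map, Polynomial.eval₂_at_apply residue (constAnalytic c) |>.symm.trans ?_]
  simp

theorem map_residue_comp (p : analyticGerms[X]) (c : ℂ) :
    (p.comp (C (constAnalytic c) * X)).map residue = (p.map residue).comp (C c * X) := by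
  rw [Polynomial.map_comp]; simp

end

noncomputable section

/-! ### Convergence of the power series solution -/

/-- An analytic function has a power series whose coefficients grow at most geometrically. -/
theorem exists_coeff_of_analyticAt {f : ℂ → ℂ} (hf : AnalyticAt ℂ f 0) :
    ∃ (b : ℕ → ℂ) (R : ℝ), 1 ≤ R ∧ (∀ k, ‖b k‖ ≤ R * R ^ k) ∧
      ∀ᶠ z in 𝓝 (0 : ℂ), HasSum (fun k => b k * z ^ k) (f z) := by
  obtain ⟨p, hp⟩ := hf
  have h := hasFPowerSeriesAt_iff.1 hp
  simp only [zero_add, smul_eq_mul] at h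
  obtain ⟨ε, hε, hball⟩ := Metric.eventually_nhds_iff.1 h
  have hr : dist ((ε / 2 : ℝ) : ℂ) 0 < ε := by
    rw [dist_zero_right, Complex.norm_real, Real.norm_of_nonneg (by positivity)]
    linarith
  -- The terms of the series at the point `ε / 2` of the disc tend to `0`, so they are bounded; this
  -- gives Cauchy's estimate for the coefficients.
  obtain ⟨M, hM⟩ := (hball hr).summable.tendsto_atTop_zero.norm.bddAbove_range
  have hM' : ∀ k, ‖p.coeff k‖ ≤ M * (2 / ε) ^ k := fun k => by
    have h1 : ‖((ε / 2 : ℝ) : ℂ) ^ k * p.coeff k‖ ≤ M := hM ⟨k, rfl⟩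
    rw [norm_mul, norm_pow, Complex.norm_real, Real.norm_of_nonneg (by positivity)] at h1
    have h2 : (2 / ε) ^ k * (ε / 2) ^ k = 1 := by
      rw [← mul_pow, div_mul_div_cancel₀ hε.ne', div_self two_ne_zero, one_pow]
    calc ‖p.coeff k‖ = (2 / ε) ^ k * ((ε / 2) ^ k * ‖p.coeff k‖) := by rw [← mul_assoc, h2, one_mul]
      _ ≤ (2 / ε) ^ k * M := by gcongr
      _ = _ := mul_comm _ _
  refine ⟨p.coeff, max 1 (max M (2 / ε)), le_max_left _ _, fun k => (hM' k).trans ?_,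
    h.mono fun z hz => by simpa only [mul_comm] using hz⟩
  gcongr
  · exact (le_max_left _ _).trans (le_max_right _ _)
  · exact (le_max_right _ _).trans (le_max_right _ _)

theorem summable_norm_coeff_mul_pow {b : ℕ → ℂ} {T R : ℝ} (hR : 0 < R)
    (hb : ∀ k, ‖b k‖ ≤ T * R ^ k) {z : ℂ} (hz : ‖z‖ < R⁻¹) : Summable fun k => ‖b k * z ^ k‖ := by
  have h1 : R * ‖z‖ < 1 := by
    calc R * ‖z‖ < R * R⁻¹ := by gcongr
      _ = 1 := mul_inv_cancel₀ hR.ne'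
  refine Summable.of_nonneg_of_le (fun _ => norm_nonneg _) (fun k => ?_)
    ((summable_geometric_of_lt_one (by positivity) h1).mul_left T)
  rw [norm_mul, norm_pow, mul_pow, ← mul_assoc]
  gcongr
  exact hb k

theorem eventually_norm_lt {r : ℝ} (hr : 0 < r) : ∀ᶠ z in 𝓝 (0 : ℂ), ‖z‖ < r := by
  filter_upwards [Metric.ball_mem_nhds (0 : ℂ) hr] with z hz using by simpa using hz

/-- A power series with coefficients growing at most geometrically is analytic. -/
theorem analyticAt_tsum {b : ℕ → ℂ} {T R : ℝ} (hR : 0 < R) (hb : ∀ k, ‖b k‖ ≤ T * R ^ k) :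
    AnalyticAt ℂ (fun z => ∑' k, b k * z ^ k) 0 := by
  refine ⟨FormalMultilinearSeries.ofScalars ℂ b, hasFPowerSeriesAt_iff.2 ?_⟩
  filter_upwards [eventually_norm_lt (inv_pos.2 hR)] with z hz
  have := (summable_norm_coeff_mul_pow hR hb hz).of_norm.hasSum
  simpa [FormalMultilinearSeries.coeff_ofScalars, mul_comm] using this

/-- The solution of a triangular linear system. -/
def triangularSol (W : ℕ → ℕ → ℂ) (V : ℕ → ℂ) : ℕ → ℂ
  | m => (V m - ∑ k : Fin m, W m k * triangularSol W V k) / W m m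
decreasing_by exact k.2

theorem sum_triangularSol (W : ℕ → ℕ → ℂ) (V : ℕ → ℂ) (m : ℕ) (hW : W m m ≠ 0) :
    ∑ k ∈ Finset.range (m + 1), W m k * triangularSol W V k = V m := by
  rw [Finset.sum_range_succ, Finset.sum_range]
  conv_lhs => rw [triangularSol.eq_1 W V m]
  field_simp
  ring

/-- After division by the diagonal entry and by `R ^ m`, the unknowns satisfy `x_m ≤ T (1 + ∑_{k<m}
x_k)`. The sequence `T (1 + T)^m` solves this recursion with equality, by the geometric sum. -/
theorem norm_triangularSol_le {W : ℕ → ℕ → ℂ} {V : ℕ → ℂ} {T R : ℝ} (hT : 0 ≤ T) (hR : 0 < R)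
    (hV : ∀ m, ‖V m‖ ≤ T * R ^ m * ‖W m m‖)
    (hW : ∀ m k, k < m → ‖W m k‖ ≤ T * R ^ (m - k) * ‖W m m‖) (hW0 : ∀ m, W m m ≠ 0) (m : ℕ) :
    ‖triangularSol W V m‖ ≤ T * (R * (1 + T)) ^ m := by
  induction m using Nat.strong_induction_on with | _ m ih =>
  rw [triangularSol, norm_div, div_le_iff₀ (norm_pos_iff.2 (hW0 m))]
  have h1 : ‖∑ k : Fin m, W m k * triangularSol W V k‖ ≤
      ∑ k ∈ Finset.range m, T * R ^ m * ‖W m m‖ * (T * (1 + T) ^ k) := by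
    rw [← Finset.sum_range fun k => W m k * triangularSol W V k]
    refine (norm_sum_le _ _).trans (Finset.sum_le_sum fun k hk => ?_)
    have hk' := Finset.mem_range.1 hk
    rw [norm_mul]
    calc ‖W m k‖ * ‖triangularSol W V k‖
        ≤ (T * R ^ (m - k) * ‖W m m‖) * (T * (R * (1 + T)) ^ k) := by
          gcongr
          · exact hW m k hk'
          · exact ih k hk'
      _ = T * (R ^ (m - k) * R ^ k) * ‖W m m‖ * (T * (1 + T) ^ k) := by rw [mul_pow]; ring
      _ = _ := by rw [← pow_add, Nat.sub_add_cancel hk'.le]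
  have h2 : T * ∑ k ∈ Finset.range m, (1 + T) ^ k = (1 + T) ^ m - 1 := by
    have := geom_sum_mul (1 + T) m
    rw [add_sub_cancel_left] at this
    rw [mul_comm, this]
  calc ‖V m - ∑ k : Fin m, W m k * triangularSol W V k‖
      ≤ T * R ^ m * ‖W m m‖ + ∑ k ∈ Finset.range m, T * R ^ m * ‖W m m‖ * (T * (1 + T) ^ k) :=
        (norm_sub_le _ _).trans (add_le_add (hV m) h1)
    _ = T * R ^ m * ‖W m m‖ * (1 + T * ∑ k ∈ Finset.range m, (1 + T) ^ k) := by
        rw [← Finset.mul_sum, ← Finset.mul_sum]; ring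
    _ = T * (R * (1 + T)) ^ m * ‖W m m‖ := by rw [h2, mul_pow]; ring

open Polynomial

/-- A polynomial of degree `n` without zeros on `{q ^ m}` is bounded below by `δ |q| ^ {m n}`. -/
theorem exists_lower_bound_eval {q : ℂ} (hq : 1 < ‖q‖) {P : ℂ[X]}
    (hP : ∀ m : ℕ, P.eval (q ^ m) ≠ 0) :
    ∃ δ : ℝ, 0 < δ ∧ ∀ m : ℕ, δ * (‖q‖ ^ m) ^ P.natDegree ≤ ‖P.eval (q ^ m)‖ := by
  have hq0 := q_ne_zero hq
  have hP0 : P ≠ 0 := fun h => hP 0 (by simp [h])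
  have key : ∀ m : ℕ, P.reverse.eval ((q ^ m)⁻¹) * (q ^ m) ^ P.natDegree = P.eval (q ^ m) :=
    fun m => by
      let _ : Invertible (q ^ m) := invertibleOfNonzero (pow_ne_zero m hq0)
      have := eval₂_reverse_mul_pow (RingHom.id ℂ) (q ^ m) P
      simpa [eval₂_id, invOf_eq_inv] using this
  -- The quotient `P(q^m) / q^(m deg P)` is the reversed polynomial at `q^(-m)` and tends to the
  -- leading coefficient. Its inverse therefore converges, hence is bounded by some `M`, and `δ =
  -- M⁻¹` works.
  have hlim : Tendsto (fun m : ℕ => ‖P.reverse.eval ((q ^ m)⁻¹)‖⁻¹) atTop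
      (𝓝 ‖P.leadingCoeff‖⁻¹) := by
    have h1 : Tendsto (fun m : ℕ => (q ^ m)⁻¹) atTop (𝓝 0) := by
      simp_rw [← inv_pow]
      exact tendsto_pow_atTop_nhds_zero_of_norm_lt_one (by
        rw [norm_inv]; exact inv_lt_one_of_one_lt₀ hq)
    have h2 := (P.reverse.continuous.tendsto 0).comp h1
    rw [← Polynomial.coeff_zero_eq_eval_zero, coeff_zero_reverse] at h2
    exact h2.norm.inv₀ (norm_ne_zero_iff.2 (leadingCoeff_ne_zero.2 hP0))
  obtain ⟨M, hM⟩ := hlim.bddAbove_range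
  have hne : ∀ m : ℕ, 0 < ‖P.reverse.eval ((q ^ m)⁻¹)‖ := fun m => norm_pos_iff.2 fun h =>
    hP m (by rw [← key, h, zero_mul])
  have hMpos : 0 < M := (inv_pos.2 (hne 0)).trans_le (hM ⟨0, rfl⟩)
  refine ⟨M⁻¹, inv_pos.2 hMpos, fun m => ?_⟩
  rw [← key, norm_mul, norm_pow, norm_pow]
  gcongr
  exact (inv_le_comm₀ hMpos (hne m)).2 (hM ⟨m, rfl⟩)

theorem natDegree_comp_C_mul_X_le {A : Type*} [CommRing A] {p : A[X]} {n : ℕ}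
    (hp : p.natDegree ≤ n) (c : A) : (p.comp (C c * X)).natDegree ≤ n := by
  refine natDegree_le_iff_coeff_eq_zero.2 fun k hk => ?_
  rw [comp_C_mul_X_coeff, natDegree_le_iff_coeff_eq_zero.1 hp k hk, zero_mul]

/-- A nonresonant operator whose leading coefficient does not vanish at `0` is surjective on germs
analytic at `0`. -/
theorem exists_skewEval_eq (q : ℂ) (hq : 1 < ‖q‖) {p : analyticGerms[X]} {n : ℕ}
    (hp : p.natDegree ≤ n) (hlead : residue (p.coeff n) ≠ 0)
    (hres : ∀ m : ℕ, (p.map residue).eval (q ^ m) ≠ 0) (v : analyticGerms) :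
    ∃ u : analyticGerms, skewEval q hq p u = v := by
  choose f hf hfp using fun j => exists_analyticGerm_eq (p.coeff j)
  obtain ⟨g, hg, rfl⟩ := exists_analyticGerm_eq v
  choose b S hS1 hbS hbf using fun j => exists_coeff_of_analyticAt (hf j)
  obtain ⟨V, S', hS'1, hV, hVg⟩ := exists_coeff_of_analyticAt hg
  -- One growth constant serving the right-hand side and all the coefficients of the operator.
  set R : ℝ := S' + ∑ j ∈ Finset.range (n + 1), S j with hRdef
  have hsum0 : 0 ≤ ∑ j ∈ Finset.range (n + 1), S j :=
    Finset.sum_nonneg fun j _ => zero_le_one.trans (hS1 j)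
  have hR1 : 1 ≤ R := by linarith
  have hR0 : 0 < R := by linarith
  have hSR : ∀ j ∈ Finset.range (n + 1), S j ≤ R := fun j hj => by
    have := Finset.single_le_sum (fun j _ => zero_le_one.trans (hS1 j)) hj
    linarith
  have hb : ∀ j ∈ Finset.range (n + 1), ∀ k, ‖b j k‖ ≤ R * R ^ k := fun j hj k =>
    (hbS j k).trans (by
      have := hSR j hj
      have := hS1 j
      gcongr)
  have hV' : ∀ k, ‖V k‖ ≤ R * R ^ k := fun k => (hV k).trans (by
    have : S' ≤ R := by linarith
    gcongr)
  have hdeg : (p.map residue).natDegree = n := by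
    refine natDegree_eq_of_le_of_coeff_ne_zero ((natDegree_map_le).trans hp) ?_
    rwa [coeff_map]
  obtain ⟨δ, hδ, hlow⟩ := exists_lower_bound_eval hq hres
  rw [hdeg] at hlow
  -- Comparing coefficients of `z^m` in `∑ f_j(z) U(q^j z) = g(z)` gives the triangular system `∑_{k
  -- ≤ m} W m k u_k = V m`. Its diagonal entries are the values at `q^m` of the characteristic
  -- polynomial.
  set W : ℕ → ℕ → ℂ := fun m k => ∑ j ∈ Finset.range (n + 1), b j (m - k) * (q ^ j) ^ k with hWdef
  have hb0 : ∀ j, b j 0 = residue (p.coeff j) := fun j => by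
    rw [← hfp, residue_analyticGerm]
    have := (hbf j).self_of_nhds
    have h2 := hasSum_single (f := fun k => b j k * (0 : ℂ) ^ k) 0 (fun k hk => by simp [hk])
    simpa using h2.unique this
  have hWdiag : ∀ m, W m m = (p.map residue).eval (q ^ m) := fun m => by
    rw [Polynomial.eval_eq_sum_range' (Nat.lt_succ_of_le hdeg.le)]
    simp only [hWdef, Nat.sub_self, hb0, coeff_map]
    exact Finset.sum_congr rfl fun j _ => by
      rw [← pow_mul, ← pow_mul, mul_comm m j, mul_comm]
  have hW0 : ∀ m, W m m ≠ 0 := fun m => by rw [hWdiag]; exact hres m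
  have hWlow : ∀ m, δ * (‖q‖ ^ m) ^ n ≤ ‖W m m‖ := fun m => by rw [hWdiag]; exact hlow m
  -- Each of the `n + 1` summands of an off-diagonal entry is at most `R R^(m-k) |q|^(mn)`, while
  -- the diagonal entry is at least `δ |q|^(mn)`.
  set T : ℝ := (n + 1) * R / δ with hTdef
  have hT : 0 ≤ T := by positivity
  have hTδ : ∀ (x : ℝ) (m : ℕ), 0 ≤ x →
      (n + 1) * R * x * (‖q‖ ^ m) ^ n ≤ T * x * ‖W m m‖ := fun x m hx => by
    calc (n + 1) * R * x * (‖q‖ ^ m) ^ n = T * x * (δ * (‖q‖ ^ m) ^ n) := by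
          rw [hTdef]; field_simp
      _ ≤ _ := by gcongr; exact hWlow m
  have hWb : ∀ m k, k < m → ‖W m k‖ ≤ T * R ^ (m - k) * ‖W m m‖ := fun m k hk => by
    refine le_trans ?_ (hTδ _ m (by positivity))
    calc ‖W m k‖ ≤ ∑ j ∈ Finset.range (n + 1), R * R ^ (m - k) * (‖q‖ ^ m) ^ n := by
          refine (norm_sum_le _ _).trans (Finset.sum_le_sum fun j hj => ?_)
          rw [norm_mul, norm_pow, norm_pow]
          have h1 : (‖q‖ ^ j) ^ k ≤ (‖q‖ ^ m) ^ n := by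
            rw [← pow_mul, ← pow_mul, mul_comm j k]
            exact pow_le_pow_right₀ hq.le
              (Nat.mul_le_mul hk.le (Nat.lt_succ_iff.1 (Finset.mem_range.1 hj)))
          gcongr
          exact hb j hj _
      _ = _ := by rw [Finset.sum_const, Finset.card_range, nsmul_eq_mul]; push_cast; ring
  have hVb : ∀ m, ‖V m‖ ≤ T * R ^ m * ‖W m m‖ := fun m => by
    refine (hV' m).trans (le_trans ?_ (hTδ _ m (by positivity)))
    have h1 : (1 : ℝ) ≤ (‖q‖ ^ m) ^ n := one_le_pow₀ (one_le_pow₀ hq.le)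
    have h2 : (1 : ℝ) ≤ n + 1 := by simp
    calc R * R ^ m = 1 * (R * R ^ m) * 1 := by ring
      _ ≤ (n + 1) * (R * R ^ m) * (‖q‖ ^ m) ^ n := by gcongr
      _ = _ := by ring
  set u := triangularSol W V with hu
  have hub := norm_triangularSol_le hT hR0 hVb hWb hW0
  rw [← hu] at hub
  have hA : 0 < R * (1 + T) := by positivity
  have hU := analyticAt_tsum hA hub
  set U : ℂ → ℂ := fun z => ∑' k, u k * z ^ k with hUdef
  refine ⟨analyticGerm U hU, ?_⟩
  refine (skewEval_coe q hq hp (fun j => congrArg Subtype.val (hfp j)) U).trans ?_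
  refine coe_eq_of_eventually (Filter.Eventually.filter_mono nhdsWithin_le_nhds ?_)
  have hev : ∀ j : ℕ, ∀ᶠ z in 𝓝 (0 : ℂ), ‖q ^ j * z‖ < (R * (1 + T))⁻¹ := fun j => by
    have : Tendsto (fun z : ℂ => q ^ j * z) (𝓝 0) (𝓝 0) := by
      simpa using (continuous_const_mul (q ^ j)).tendsto 0
    exact this.eventually (eventually_norm_lt (inv_pos.2 hA))
  have hev2 := (Finset.range (n + 1)).eventually_all.2 fun j _ => (hev j).and (hbf j)
  filter_upwards [hev2, hVg, eventually_norm_lt (inv_pos.2 hR0)] with z hz hVz hzR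
  have hterm : ∀ j ∈ Finset.range (n + 1), HasSum (fun N => ∑ k ∈ Finset.range (N + 1),
      (u k * (q ^ j * z) ^ k) * (b j (N - k) * z ^ (N - k))) (f j z * U (q ^ j * z)) :=
    fun j hj => by
      have := hasSum_sum_range_mul_of_summable_norm
        (summable_norm_coeff_mul_pow hA hub (hz j hj).1)
        (summable_norm_coeff_mul_pow hR0 (hb j hj) hzR)
      rwa [(hz j hj).2.tsum_eq, mul_comm (∑' n, _)] at this
  have htot := hasSum_sum hterm
  refine htot.unique ?_
  convert hVz using 2 with N
  rw [← sum_triangularSol W V N (hW0 N), Finset.sum_comm, Finset.sum_mul]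
  refine Finset.sum_congr rfl fun k hk => ?_
  have hk' : k ≤ N := Nat.lt_succ_iff.1 (Finset.mem_range.1 hk)
  rw [hWdef]
  simp only [Finset.sum_mul]
  refine Finset.sum_congr rfl fun j _ => ?_
  rw [mul_pow, ← hu, ← Nat.sub_add_cancel hk', pow_add]
  simp only [Nat.add_sub_cancel]
  ring

/-- If `1` is the only root of the characteristic polynomial on `{q ^ m}`, there is a solution
analytic at `0` with value `1` there. -/
theorem exists_skewEval_eq_zero (q : ℂ) (hq : 1 < ‖q‖) {p : analyticGerms[X]} {n : ℕ}
    (hp : p.natDegree ≤ n) (hlead : residue (p.coeff n) ≠ 0)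
    (h1 : (p.map residue).eval 1 = 0)
    (hres : ∀ m : ℕ, (p.map residue).eval (q ^ (m + 1)) ≠ 0) :
    ∃ u : analyticGerms, residue u = 1 ∧ skewEval q hq p u = 0 := by
  have hq0 := q_ne_zero hq
  have hr : residue (p.eval 1) = 0 := by
    have := residue_eval p 1
    rw [map_one] at this
    rw [this, h1]
  -- The solution is sought as `u = 1 + z w`. The operator sends `1` to a germ `z v`, and
  -- conjugation by `z` replaces `X` by `q X`, which makes the equation for `w` nonresonant.
  obtain ⟨v, hv⟩ := exists_eq_zmon_one_mul hr
  obtain ⟨w, hw⟩ := exists_skewEval_eq q hq (p := p.comp (C (constAnalytic q) * X)) (n := n)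
    (natDegree_comp_C_mul_X_le hp _)
    (by
      rw [comp_C_mul_X_coeff, map_mul, map_pow, residue_constAnalytic]
      exact mul_ne_zero hlead (pow_ne_zero _ hq0))
    (fun m => by
      rw [map_residue_comp, eval_comp]
      simpa [pow_succ'] using hres m) (-v)
  have hzan : AnalyticAt ℂ (fun z : ℂ => z ^ (1 : ℤ)) 0 := by
    simp only [zpow_one]; exact analyticAt_id
  set Z := analyticGerm _ hzan with hZ
  refine ⟨1 + Z * w, by simp [hZ], ?_⟩
  have hcoe : ((1 + Z * w : analyticGerms) : OriginGerm) = 1 + zmon 1 * w := rfl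
  rw [hcoe, skewEval_map_add, skewEval_one,
    skewEval_mul q hq (c := q) (by simpa using sigma_zmon q hq 1), hw, hv]
  push_cast
  ring

end

noncomputable section

/-! ### Meromorphic continuation of solutions -/

theorem eventually_nhdsNE_ne_zero (z : ℂ) : ∀ᶠ w in 𝓝[≠] z, w ≠ 0 := by
  by_cases hz : z = 0
  · subst hz
    exact eventually_mem_nhdsWithin
  · exact (eventually_ne_nhds hz).filter_mono nhdsWithin_le_nhds

theorem tendsto_const_mul_nhdsNE {c : ℂ} (hc : c ≠ 0) (z : ℂ) :
    Tendsto (fun w => c * w) (𝓝[≠] z) (𝓝[≠] (c * z)) :=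
  tendsto_nhdsWithin_of_tendsto_nhds_of_eventually_within _
    ((continuous_const_mul c).continuousAt.mono_left nhdsWithin_le_nhds)
    (eventually_mem_nhdsWithin.mono fun _ hw h => hw (mul_left_cancel₀ hc h))

theorem meromorphicAt_comp_const_mul {f : ℂ → ℂ} {c z : ℂ} (h : MeromorphicAt f (c * z)) :
    MeromorphicAt (fun w => f (c * w)) z := by
  have h2 : AnalyticAt ℂ (fun w => c * w) z := by fun_prop
  exact h.comp_analyticAt h2

/-- A solution of a `q`-difference equation meromorphic at `0` extends meromorphically to `ℂ`. -/
theorem exists_meromorphic_extension {q : ℂ} (hq : 1 < ‖q‖) {n : ℕ} {α : ℕ → ℂ → ℂ} {γ U : ℂ → ℂ}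
    (hα : ∀ j z, MeromorphicAt (α j) z) (hγ : ∀ z, MeromorphicAt γ z) (hU : MeromorphicAt U 0)
    (heq : ∀ᶠ z in 𝓝[≠] (0 : ℂ), ∑ j ∈ Finset.range (n + 1), α j z * U (q ^ j * z) = γ z)
    (hne : ∀ᶠ z in 𝓝[≠] (0 : ℂ), α n z ≠ 0) :
    ∃ F : ℂ → ℂ, (∀ z, MeromorphicAt F z) ∧ ∀ᶠ z in 𝓝[≠] (0 : ℂ), F z = U z := by
  have hq0 := q_ne_zero hq
  have hqpos : 0 < ‖q‖ := one_pos.trans hq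
  set s : ℂ := (q ^ n)⁻¹ with hs
  have hs0 : s ≠ 0 := inv_ne_zero (pow_ne_zero _ hq0)
  -- The equation at `q^(-n) z`, solved for the leading term. The value of `Φ f` at `z` only uses
  -- `f` at points of modulus at most `|z| / |q|`, so each application enlarges the disc of
  -- meromorphy by the factor `|q|`.
  set Φ : (ℂ → ℂ) → ℂ → ℂ := fun f z =>
    (γ (s * z) - ∑ j ∈ Finset.range n, α j (s * z) * f (q ^ j * s * z)) / α n (s * z) with hΦ
  have hfix : ∀ᶠ z in 𝓝[≠] (0 : ℂ), Φ U z = U z := by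
    have ht := tendsto_const_mul_nhdsNE hs0 0
    rw [mul_zero] at ht
    filter_upwards [ht.eventually heq, ht.eventually hne] with z h1 h2
    rw [Finset.sum_range_succ, ← mul_assoc, hs, mul_inv_cancel₀ (pow_ne_zero _ hq0), one_mul] at h1
    rw [hΦ, div_eq_iff h2, ← h1]
    simp only [mul_assoc, hs]
    ring
  obtain ⟨ρ, hρ, hball⟩ : ∃ ρ : ℝ, 0 < ρ ∧ ∀ z : ℂ, ‖z‖ < ρ →
      MeromorphicAt U z ∧ (z ≠ 0 → Φ U z = U z) := by
    have h1 : ∀ᶠ z in 𝓝 (0 : ℂ), MeromorphicAt U z := by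
      have := hU.eventually_analyticAt
      rw [eventually_nhdsWithin_iff] at this
      filter_upwards [this] with z hz
      by_cases h0 : z = 0
      · rwa [h0]
      · exact (hz h0).meromorphicAt
    obtain ⟨ρ, hρ, h⟩ := Metric.eventually_nhds_iff.1 (h1.and (eventually_nhdsWithin_iff.1 hfix))
    exact ⟨ρ, hρ, fun z hz => h (by rwa [dist_zero_right])⟩
  have hshrink : ∀ (k j : ℕ) (z : ℂ), j < n → ‖z‖ < ‖q‖ ^ (k + 1) * ρ →
      ‖q ^ j * s * z‖ < ‖q‖ ^ k * ρ := fun k j z hj hz => by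
    have h1 : ‖q ^ j * s‖ ≤ ‖q‖⁻¹ := by
      rw [norm_mul, hs, norm_inv, norm_pow, norm_pow, ← div_eq_mul_inv,
        div_le_iff₀ (pow_pos hqpos n), inv_mul_eq_div, le_div_iff₀ hqpos, ← pow_succ]
      exact pow_le_pow_right₀ hq.le hj
    calc ‖q ^ j * s * z‖ = ‖q ^ j * s‖ * ‖z‖ := norm_mul _ _
      _ ≤ ‖q‖⁻¹ * ‖z‖ := by gcongr
      _ < ‖q‖⁻¹ * (‖q‖ ^ (k + 1) * ρ) := by gcongr
      _ = ‖q‖ ^ k * ρ := by rw [pow_succ]; field_simp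
  set F : ℕ → ℂ → ℂ := fun k => Φ^[k] U with hF
  have hFsucc : ∀ k, F (k + 1) = Φ (F k) := fun k => Function.iterate_succ_apply' Φ k U
  have hmer : ∀ k z, ‖z‖ < ‖q‖ ^ k * ρ → MeromorphicAt (F k) z := by
    intro k
    induction k with
    | zero => exact fun z hz => (hball z (by simpa using hz)).1
    | succ k ih =>
      intro z hz
      rw [hFsucc]
      refine ((meromorphicAt_comp_const_mul (hγ _)).sub (MeromorphicAt.fun_sum fun j hj => ?_)).div
        (meromorphicAt_comp_const_mul (hα _ _))
      exact (meromorphicAt_comp_const_mul (hα _ _)).mul (meromorphicAt_comp_const_mul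
        (ih _ (hshrink k j z (Finset.mem_range.1 hj) hz)))
  have hstep : ∀ k z, ‖z‖ < ‖q‖ ^ k * ρ → ∀ᶠ w in 𝓝[≠] z, F (k + 1) w = F k w := by
    intro k
    induction k with
    | zero =>
      intro z hz
      have h1 : ∀ᶠ w in 𝓝[≠] z, ‖w‖ < ρ :=
        (continuous_norm.continuousAt.eventually_lt_const (by simpa using hz)).filter_mono
          nhdsWithin_le_nhds
      filter_upwards [h1, eventually_nhdsNE_ne_zero z] with w hw hw0
      exact (hball w hw).2 hw0
    | succ k ih =>
      intro z hz
      have h1 : ∀ᶠ w in 𝓝[≠] z, ∀ j ∈ Finset.range n,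
          F (k + 1) (q ^ j * s * w) = F k (q ^ j * s * w) :=
        (Finset.range n).eventually_all.2 fun j hj =>
          (tendsto_const_mul_nhdsNE (mul_ne_zero (pow_ne_zero _ hq0) hs0) z).eventually
            (ih _ (hshrink k j z (Finset.mem_range.1 hj) hz))
      filter_upwards [h1] with w hw
      have h2 : ∑ j ∈ Finset.range n, α j (s * w) * F (k + 1) (q ^ j * s * w) =
          ∑ j ∈ Finset.range n, α j (s * w) * F k (q ^ j * s * w) :=
        Finset.sum_congr rfl fun j hj => by rw [hw j hj]
      calc F (k + 1 + 1) w = Φ (F (k + 1)) w := by rw [hFsucc (k + 1)]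
        _ = Φ (F k) w := congrArg (fun x => (γ (s * w) - x) / α n (s * w)) h2
        _ = F (k + 1) w := by rw [hFsucc k]
  have hstab : ∀ k m z, k ≤ m → ‖z‖ < ‖q‖ ^ k * ρ → ∀ᶠ w in 𝓝[≠] z, F m w = F k w := by
    intro k m z hkm hz
    induction m, hkm using Nat.le_induction with
    | base => exact Eventually.of_forall fun _ => rfl
    | succ m hkm ih =>
      have h2 : ‖z‖ < ‖q‖ ^ m * ρ := hz.trans_le (by gcongr; exact hq.le)
      filter_upwards [ih, hstep m z h2] with w h3 h4 using h4.trans h3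
  -- A radius smaller than `ρ` gives room for gluing. If `|z| ≥ |q|^i ρ`, no point near `z` lies in
  -- the disc of radius `|q|^i r`; otherwise `F i` and `F k` already agree near `z`.
  set r : ℝ := ρ / ‖q‖ with hr
  have hr0 : 0 < r := by positivity
  have hrρ : r < ρ := div_lt_self hρ hq
  have hex : ∀ z : ℂ, ∃ k : ℕ, ‖z‖ < ‖q‖ ^ k * r := fun z => by
    obtain ⟨k, hk⟩ := pow_unbounded_of_one_lt (‖z‖ / r) hq
    exact ⟨k, (div_lt_iff₀ hr0).1 hk⟩
  classical
  have hglue : ∀ (z : ℂ) (k : ℕ), ‖z‖ < ‖q‖ ^ k * r →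
      ∀ᶠ w in 𝓝[≠] z, F (Nat.find (hex w)) w = F k w := by
    intro z k hk
    have h1 : ∀ᶠ w in 𝓝[≠] z, ‖w‖ < ‖q‖ ^ k * r :=
      (continuous_norm.continuousAt.eventually_lt_const hk).filter_mono nhdsWithin_le_nhds
    have h2 : ∀ᶠ w in 𝓝[≠] z, ∀ i ∈ Finset.range (k + 1), ‖w‖ < ‖q‖ ^ i * r → F i w = F k w := by
      refine (Finset.range (k + 1)).eventually_all.2 fun i hi => ?_
      rcases lt_or_ge ‖z‖ (‖q‖ ^ i * ρ) with hz | hz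
      · filter_upwards [hstab i k z (Nat.lt_succ_iff.1 (Finset.mem_range.1 hi)) hz] with w hw _
        exact hw.symm
      · have h3 : ‖q‖ ^ i * r < ‖z‖ := lt_of_lt_of_le (by gcongr) hz
        filter_upwards [(continuous_norm.continuousAt.eventually_const_lt h3).filter_mono
          nhdsWithin_le_nhds] with w hw hw'
        exact absurd hw' hw.not_gt
    filter_upwards [h1, h2] with w h3 h4
    exact h4 _ (Finset.mem_range.2 (Nat.lt_succ_of_le (Nat.find_min' _ h3))) (Nat.find_spec (hex w))
  refine ⟨fun w => F (Nat.find (hex w)) w, fun z => ?_, ?_⟩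
  · obtain ⟨k, hk⟩ := hex z
    refine (hmer k z (hk.trans (by gcongr))).congr ?_
    exact (hglue z k hk).mono fun w hw => hw.symm
  · exact hglue 0 0 (by simpa using hr0)

open Polynomial

/-- Solutions are constructed as germs at `0`; this returns them to the base field. Only the case of
the whole plane needs an argument, namely continuation by the equation. -/
theorem mem_K_of_skewEval_mem (q : ℂ) (hq : 1 < ‖q‖) {C : ConvergentCase} {p : analyticGerms[X]}
    {n : ℕ} (hp : p.natDegree ≤ n) (hpK : ∀ j, (p.coeff j : OriginGerm) ∈ C.K)
    (hlead : p.coeff n ≠ 0) {u : OriginGerm} (hu : u ∈ ConvergentCase.germ.K)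
    (h : skewEval q hq p u ∈ C.K) : u ∈ C.K := by
  cases C with
  | germ => exact hu
  | entire =>
    choose α hα hαp using hpK
    obtain ⟨γ, hγ, hγp⟩ := h
    simp only [eventually_principal, Set.mem_univ, true_imp_iff] at hα hγ
    obtain ⟨U, hU, rfl⟩ := exists_rep_of_mem_germK hu
    rw [skewEval_coe q hq hp hαp] at hγp
    have hsum : MeromorphicAt
        (fun z => ∑ j ∈ Finset.range (n + 1), α j z * U (q ^ j * z)) 0 :=
      MeromorphicAt.fun_sum fun j _ =>
        (hα j 0).mul (meromorphicAt_comp_const_mul (by simpa using hU))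
    obtain ⟨F, hF, hFU⟩ := exists_meromorphic_extension hq hα hγ hU
      (eventuallyEq_of_coe_eq hsum (hγ 0) hγp.symm)
      (eventually_ne_zero_of_coe_ne_zero (hα n 0) fun h0 => hlead (Subtype.ext (by
        rw [← hαp n, h0]; rfl)))
    rw [← coe_eq_of_eventually hFU]
    exact coe_mem_K hF _

/-! ### Inhomogeneous equations of order one -/

theorem skewEval_linear (q : ℂ) (hq : 1 < ‖q‖) (d c : ℂ) (y : OriginGerm) :
    skewEval q hq (C (constAnalytic d) * X - C (constAnalytic c)) y =
      constGerm d * sigma q hq y - constGerm c * y := by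
  rw [sub_eq_add_neg, ← C_neg, ← map_neg, C_mul_X_eq_monomial, ← monomial_zero_left, skewEval_add,
    skewEval_monomial, skewEval_monomial]
  simp [sub_eq_add_neg]

theorem natDegree_linear_le {A : Type*} [CommRing A] (d c : A) :
    (C d * X - C c : A[X]).natDegree ≤ 1 :=
  (natDegree_sub_C (a := c)).le.trans (by simpa using natDegree_C_mul_X_pow_le d 1)

theorem zpow_q_injective {q : ℂ} (hq : 1 < ‖q‖) {d : ℂ} (hd : d ≠ 0) {m k : ℤ}
    (h : d * q ^ m = d * q ^ k) : m = k := by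
  have h1 := congrArg norm (mul_left_cancel₀ hd h)
  rw [norm_zpow, norm_zpow] at h1
  exact zpow_right_injective₀ (one_pos.trans hq) hq.ne' h1

/-- Induction on the number `k` of orders, from `N` on, at which resonance is still possible. The
lowest term of the right-hand side is removed by a monomial, or kept as the obstruction if `d q^N =
c`. Once no resonance remains, `y = z^N w` reduces to the surjectivity of nonresonant operators. -/
theorem exists_firstOrder_aux (q : ℂ) (hq : 1 < ‖q‖) {d c : ℂ} (hd : d ≠ 0) (k : ℕ) :
    ∀ (N : ℤ), (∀ m : ℤ, N + k ≤ m → d * q ^ m ≠ c) → ∀ v : analyticGerms,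
      ∃ y ∈ ConvergentCase.germ.K, ∃ (l : ℂ) (m : ℤ),
        constGerm d * sigma q hq y - constGerm c * y = zmon N * v - constGerm l * zmon m ∧
          (l = 0 ∨ d * q ^ m = c) := by
  have hq0 := q_ne_zero hq
  induction k with
  | zero =>
    intro N hN v
    have hd' : d * q ^ N ≠ 0 := mul_ne_zero hd (zpow_ne_zero _ hq0)
    obtain ⟨w, hw⟩ := exists_skewEval_eq q hq
      (natDegree_linear_le (constAnalytic (d * q ^ N)) (constAnalytic c))
      (by simpa [coeff_C] using ⟨hd, zpow_ne_zero N hq0⟩)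
      (fun m => by
        have := hN (N + m) (by simp)
        rw [zpow_add₀ hq0, ← mul_assoc] at this
        simpa [sub_eq_zero] using this) v
    rw [skewEval_linear] at hw
    refine ⟨zmon N * w, mul_mem (zmon_mem_K _ _) (analyticGerms_le_germK w.2), 0, 0, ?_, Or.inl rfl⟩
    rw [← hw, map_mul, sigma_zmon, map_mul, map_zero]
    ring
  | succ k ih =>
    intro N hN v
    have h0 : residue (v - constAnalytic (residue v)) = 0 := by simp
    obtain ⟨v', hv'⟩ := exists_eq_zmon_one_mul h0
    have hv : (v : OriginGerm) = constGerm (residue v) + zmon 1 * v' := by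
      rw [← hv']; push_cast; rw [coe_constAnalytic]; ring
    obtain ⟨y, hy, l, m, hylm, hlm⟩ := ih (N + 1) (fun m hm => hN m (by push_cast; linarith)) v'
    rw [zmon_add] at hylm
    by_cases hres : d * q ^ N = c
    · refine ⟨y, hy, l + residue v, N, ?_, Or.inr hres⟩
      -- Since `|q| > 1`, there is at most one resonant exponent, so the obstruction left by the
      -- tail merges with the new one.
      have hl : constGerm l * zmon m = constGerm l * zmon N := by
        rcases hlm with rfl | hm
        · simp
        · rw [zpow_q_injective hq hd (hm.trans hres.symm)]
      rw [hylm, hl, hv]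
      rw [map_add]
      ring
    · refine ⟨y + constGerm (residue v / (d * q ^ N - c)) * zmon N,
        add_mem hy (mul_mem (constGerm_mem_K _ _) (zmon_mem_K _ _)), l, m, ?_, hlm⟩
      have h1 : constGerm (residue v) = (constGerm d * constGerm (q ^ N) - constGerm c) *
          constGerm (residue v / (d * q ^ N - c)) := by
        rw [← map_mul, ← map_sub, ← map_mul, mul_div_cancel₀ _ (sub_ne_zero.2 hres)]
      rw [map_add, map_mul, sigma_zmon, sigma_constGerm, hv, h1, mul_add (zmon N)]
      linear_combination hylm

/-- The equation `d σ y - c y = v` is solvable up to a resonant monomial. -/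
theorem exists_firstOrder (q : ℂ) (hq : 1 < ‖q‖) {C : ConvergentCase} {d c : ℂ} (hd : d ≠ 0)
    {v : OriginGerm} (hv : v ∈ C.K) :
    ∃ y ∈ C.K, ∃ (l : ℂ) (m : ℤ),
      constGerm d * sigma q hq y - constGerm c * y = v - constGerm l * zmon m ∧
        (l = 0 ∨ d * q ^ m = c) := by
  obtain ⟨N, w, rfl⟩ := exists_eq_zmon_mul (C.K_le_germ_K hv)
  have hk : ∃ k : ℕ, ∀ m : ℤ, N + k ≤ m → d * q ^ m ≠ c := by
    by_cases h : ∃ m : ℤ, d * q ^ m = c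
    · obtain ⟨m, hm⟩ := h
      refine ⟨(m + 1 - N).toNat, fun m' hm' h' => ?_⟩
      have := zpow_q_injective hq hd (h'.trans hm.symm)
      have := Int.self_le_toNat (m + 1 - N)
      omega
    · push Not at h
      exact ⟨0, fun m _ => h m⟩
  obtain ⟨k, hk⟩ := hk
  obtain ⟨y, hy, l, m, hylm, hlm⟩ := exists_firstOrder_aux q hq hd k N hk w
  refine ⟨y, ?_, l, m, hylm, hlm⟩
  refine mem_K_of_skewEval_mem q hq
    (natDegree_linear_le (constAnalytic d) (constAnalytic c)) (fun j => ?_) ?_ hy ?_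
  · rw [coeff_sub, coeff_C_mul, coeff_X, coeff_C]
    refine sub_mem (mul_mem (constGerm_mem_K d C) ?_) ?_
    · split_ifs
      exacts [one_mem _, zero_mem _]
    · split_ifs
      exacts [constGerm_mem_K c C, zero_mem _]
  · intro h0
    have := congrArg residue h0
    simp [coeff_C, hd] at this
  · rw [skewEval_linear, hylm]
    exact sub_mem hv (mul_mem (constGerm_mem_K _ _) (zmon_mem_K _ _))

end

noncomputable section

/-! ### The theta function -/

theorem triangular_succ (m : ℤ) : (m + 1) * (m + 1 - 1) / 2 = m * (m - 1) / 2 + m := by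
  rw [← Int.add_mul_ediv_right _ _ two_ne_zero]
  congr 1
  ring

/-- A summable bound for the terms of the theta series on the annulus `R⁻¹ ≤ |z| ≤ R`. -/
def thetaBound (Q R : ℝ) (m : ℤ) : ℝ := Q ^ (-(m * (m - 1) / 2)) * R ^ m.natAbs

theorem summable_thetaBound {Q R : ℝ} (hQ : 1 < Q) (hR : 0 < R) : Summable (thetaBound Q R) := by
  have hQ0 : 0 < Q := one_pos.trans hQ
  have hpos : ∀ m, 0 < thetaBound Q R m := fun m => by unfold thetaBound; positivity
  have hlim : Tendsto (fun m : ℕ => R * Q⁻¹ ^ m) atTop (𝓝 0) := by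
    simpa using (tendsto_pow_atTop_nhds_zero_of_lt_one (inv_nonneg.2 hQ0.le)
      (inv_lt_one_of_one_lt₀ hQ)).const_mul R
  refine Summable.of_nat_of_neg ?_ ?_
  · refine summable_of_ratio_test_tendsto_lt_one zero_lt_one
      (Eventually.of_forall fun m => (hpos _).ne') (hlim.congr fun m => ?_)
    rw [Real.norm_of_nonneg (hpos _).le, Real.norm_of_nonneg (hpos _).le, eq_div_iff (hpos _).ne']
    simp only [thetaBound]
    rw [Nat.cast_succ, triangular_succ, neg_add, zpow_add₀ hQ0.ne', zpow_neg Q (m : ℤ), zpow_natCast,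
      show ((m : ℤ) + 1).natAbs = m + 1 by omega, Int.natAbs_natCast, pow_succ, inv_pow]
    ring
  · refine summable_of_ratio_test_tendsto_lt_one zero_lt_one
      (Eventually.of_forall fun m => (hpos _).ne')
      (((hlim.comp (tendsto_add_atTop_nat 1))).congr fun m => ?_)
    rw [Real.norm_of_nonneg (hpos _).le, Real.norm_of_nonneg (hpos _).le, eq_div_iff (hpos _).ne']
    simp only [thetaBound, Function.comp]
    have h := triangular_succ (-((m + 1 : ℕ) : ℤ))
    rw [show -((m + 1 : ℕ) : ℤ) + 1 = -(m : ℤ) by push_cast; ring] at h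
    rw [h, neg_add, zpow_add₀ hQ0.ne', neg_neg, zpow_natCast, Int.natAbs_neg, Int.natAbs_neg,
      Int.natAbs_natCast, Int.natAbs_natCast, pow_succ R m, inv_pow]
    field_simp

theorem norm_theta_term_le (q : ℂ) {R : ℝ} {z : ℂ} (hz0 : z ≠ 0) (h1 : ‖z‖ ≤ R)
    (h2 : ‖z‖⁻¹ ≤ R) (m : ℤ) :
    ‖(-1 : ℂ) ^ m * q ^ (-(m * (m - 1) / 2)) * z ^ m‖ ≤ thetaBound ‖q‖ R m := by
  rw [norm_mul, norm_mul, norm_zpow, norm_zpow, norm_zpow, norm_neg, norm_one, one_zpow, one_mul,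
    thetaBound]
  gcongr
  have hzpos := norm_pos_iff.2 hz0
  rcases Int.natAbs_eq m with h | h
  · rw [h, zpow_natCast, Int.natAbs_natCast]
    gcongr
  · rw [h, zpow_neg, zpow_natCast, ← inv_pow, Int.natAbs_neg, Int.natAbs_natCast]
    gcongr

theorem analyticAt_theta {q : ℂ} (hq : 1 < ‖q‖) {z : ℂ} (hz : z ≠ 0) :
    AnalyticAt ℂ (theta q) z := by
  have hzpos := norm_pos_iff.2 hz
  -- Chosen so that `z` lies in the open annulus `R⁻¹ < |w| < R`, on which the series is dominated
  -- by `thetaBound`.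
  set R : ℝ := ‖z‖ + ‖z‖⁻¹ + 1 with hR
  have hR0 : 0 < R := by positivity
  have hinv : 0 < ‖z‖⁻¹ := inv_pos.2 hzpos
  set U : Set ℂ := {w | ‖w‖ < R ∧ R⁻¹ < ‖w‖} with hU
  have hUo : IsOpen U :=
    (isOpen_lt continuous_norm continuous_const).inter (isOpen_lt continuous_const continuous_norm)
  have hzU : z ∈ U := ⟨by linarith, inv_lt_of_inv_lt₀ hzpos (by linarith)⟩
  have hU0 : ∀ w ∈ U, w ≠ 0 := fun w hw => norm_pos_iff.1 ((inv_pos.2 hR0).trans hw.2)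
  refine DifferentiableOn.analyticAt (s := U) ?_ (hUo.mem_nhds hzU)
  refine Complex.differentiableOn_tsum_of_summable_norm (summable_thetaBound hq hR0)
    (fun m w hw => ?_) hUo (fun m w hw => norm_theta_term_le q (hU0 w hw) hw.1.le
      (inv_le_of_inv_le₀ hR0 hw.2.le) m)
  exact ((differentiableAt_zpow.2 (Or.inl (hU0 w hw))).const_mul _).differentiableWithinAt

theorem theta_q_mul {q : ℂ} (hq : 1 < ‖q‖) {z : ℂ} (hz : z ≠ 0) :
    theta q (q * z) = -(q * z) * theta q z := by
  have hq0 := q_ne_zero hq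
  rw [theta, theta, ← (Equiv.addRight (1 : ℤ)).tsum_eq, ← tsum_mul_left]
  refine tsum_congr fun m => ?_
  rw [Equiv.coe_addRight, triangular_succ, neg_add, zpow_add₀ hq0, mul_zpow, zpow_add₀ hq0 m 1,
    zpow_add₀ hz, zpow_add₀ (by simp : (-1 : ℂ) ≠ 0), zpow_neg q m, zpow_one, zpow_one, zpow_one]
  have := zpow_ne_zero m hq0
  field_simp

theorem integral_exp_zpow {m : ℤ} :
    ∫ t in (0 : ℝ)..(2 * Real.pi), Complex.exp (t * Complex.I) ^ m =
      if m = 0 then 2 * (Real.pi : ℂ) else 0 := by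
  split_ifs with h
  · simp [h]
  · have hc : (m : ℂ) * Complex.I ≠ 0 := by simp [h]
    have h1 : ∀ t : ℝ, Complex.exp (t * Complex.I) ^ m = Complex.exp (m * Complex.I * t) :=
      fun t => by rw [← Complex.exp_int_mul]; ring_nf
    simp_rw [h1]
    rw [integral_exp_mul_complex hc]
    have h2 : Complex.exp (m * Complex.I * ((2 * Real.pi : ℝ) : ℂ)) = 1 := by
      rw [← Complex.exp_int_mul_two_pi_mul_I m]
      push_cast
      ring_nf
    rw [h2]
    simp

/-- Integrating the series termwise over the unit circle isolates its constant Laurent coefficient,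
which is `1`. -/
theorem theta_not_identically_zero {q : ℂ} (hq : 1 < ‖q‖) : ∃ z ≠ 0, theta q z ≠ 0 := by
  by_contra! hall
  have hs := summable_thetaBound hq (R := 1) one_pos
  have hnorm : ∀ t : ℝ, ‖Complex.exp (t * Complex.I)‖ = 1 := Complex.norm_exp_ofReal_mul_I
  have hle : ∀ (t : ℝ) (m : ℤ), ‖(-1 : ℂ) ^ m * q ^ (-(m * (m - 1) / 2)) *
      Complex.exp (t * Complex.I) ^ m‖ ≤ thetaBound ‖q‖ 1 m := fun t m =>
    norm_theta_term_le q (Complex.exp_ne_zero _) (hnorm t).le (by rw [hnorm]; simp) m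
  have key := intervalIntegral.hasSum_integral_of_dominated_convergence
    (μ := MeasureTheory.volume) (a := 0) (b := 2 * Real.pi)
    (F := fun (m : ℤ) (t : ℝ) => (-1 : ℂ) ^ m * q ^ (-(m * (m - 1) / 2)) *
      Complex.exp (t * Complex.I) ^ m)
    (f := fun t : ℝ => theta q (Complex.exp (t * Complex.I)))
    (fun m _ => thetaBound ‖q‖ 1 m)
    (fun m => by
      refine (Continuous.aestronglyMeasurable ?_)
      exact continuous_const.mul (Continuous.zpow₀ (by fun_prop) m
        fun t => Or.inl (Complex.exp_ne_zero _)))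
    (fun m => Eventually.of_forall fun t _ => hle t m)
    (Eventually.of_forall fun t _ => hs)
    (by simp)
    (Eventually.of_forall fun t _ => (hs.of_norm_bounded (hle t)).hasSum)
  simp only [intervalIntegral.integral_const_mul, integral_exp_zpow, mul_ite, mul_zero] at key
  have h0 : ∀ t : ℝ, theta q (Complex.exp (t * Complex.I)) = 0 := fun t =>
    hall _ (Complex.exp_ne_zero _)
  simp only [h0, intervalIntegral.integral_zero] at key
  have h1 := (hasSum_single (f := fun m : ℤ => if m = 0 then
    (-1 : ℂ) ^ m * q ^ (-(m * (m - 1) / 2)) * (2 * (Real.pi : ℂ)) else 0) 0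
    (fun m hm => if_neg hm)).unique key
  simp [Real.pi_ne_zero] at h1

/-- By the identity theorem on the connected set `ℂ*`, the zeros of `θ_q` there are isolated. Hence
quotients and powers of theta functions are units among the germs. -/
theorem eventually_theta_ne_zero {q : ℂ} (hq : 1 < ‖q‖) {c : ℂ} (hc : c ≠ 0) :
    ∀ᶠ z in originFilter, theta q (c * z) ≠ 0 := by
  have hconn : IsPreconnected ({0}ᶜ : Set ℂ) :=
    (isConnected_compl_singleton_of_one_lt_rank (by simp) (0 : ℂ)).isPreconnected
  have han : AnalyticOnNhd ℂ (theta q) {0}ᶜ := fun z hz => analyticAt_theta hq hz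
  have h : ∀ z ≠ 0, ∀ᶠ w in 𝓝[≠] z, theta q w ≠ 0 := by
    intro z hz
    by_contra hfr
    obtain ⟨w, hw, hw'⟩ := theta_not_identically_zero hq
    refine hw' (han.eqOn_zero_of_preconnected_of_frequently_eq_zero hconn hz hfr hw)
  change ∀ᶠ z in 𝓝[≠] (0 : ℂ), ∀ᶠ w in 𝓝[≠] z, theta q (c * w) ≠ 0
  filter_upwards [eventually_mem_nhdsWithin] with z hz
  exact (tendsto_const_mul_nhdsNE hc z).eventually (h _ (mul_ne_zero hc hz))

theorem eventually_originFilter_ne_zero : ∀ᶠ z in originFilter, z ≠ 0 :=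
  originFilter_le eventually_mem_nhdsWithin

/-! ### `q`-characters, the `q`-logarithm and the powers of `Θ_q` as germs -/

theorem isUnit_qChar {q : ℂ} (hq : 1 < ‖q‖) {c : ℂ} (hc : c ≠ 0) :
    IsUnit (qChar q c : OriginGerm) := by
  refine isUnit_coe ?_
  have h1 := eventually_theta_ne_zero hq one_ne_zero
  simp only [one_mul] at h1
  filter_upwards [h1, eventually_theta_ne_zero hq (inv_ne_zero hc)] with z h1 h2
  exact div_ne_zero h1 h2

theorem sigma_qChar {q : ℂ} (hq : 1 < ‖q‖) {c : ℂ} (hc : c ≠ 0) :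
    sigma q hq (qChar q c : OriginGerm) = constGerm c * (qChar q c : OriginGerm) := by
  rw [sigma_coe]
  refine coe_eq_of_forall_ne fun z hz => ?_
  have hq0 := q_ne_zero hq
  simp only [qChar]
  rw [mul_left_comm c⁻¹ q z, theta_q_mul hq hz, theta_q_mul hq (mul_ne_zero (inv_ne_zero hc) hz)]
  change _ = c * (theta q z / theta q (c⁻¹ * z))
  -- At a zero of the denominator both sides are `0`, division by zero being zero, so the identity
  -- holds at every `z ≠ 0`.
  by_cases h : theta q (c⁻¹ * z) = 0
  · simp [h]
  · field_simp

theorem sigma_qLog {q : ℂ} (hq : 1 < ‖q‖) :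
    sigma q hq (qLog q : OriginGerm) = (qLog q : OriginGerm) + 1 := by
  rw [sigma_coe]
  refine Germ.coe_eq.2 ?_
  have h1 := eventually_theta_ne_zero hq one_ne_zero
  simp only [one_mul] at h1
  filter_upwards [h1, eventually_originFilter_ne_zero] with z hθ hz
  have hq0 := q_ne_zero hq
  have hd1 : HasDerivAt (fun w => theta q (q * w)) (deriv (theta q) (q * z) * q) z := by
    have h2 : HasDerivAt (fun w => q * w) q z := by simpa using (hasDerivAt_id z).const_mul q
    exact (analyticAt_theta hq (mul_ne_zero hq0 hz)).differentiableAt.hasDerivAt.comp z h2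
  have hd2 : HasDerivAt (fun w => -(q * w) * theta q w)
      (-q * theta q z + -(q * z) * deriv (theta q) z) z := by
    have h2 : HasDerivAt (fun w => -(q * w)) (-q) z := by
      simpa using ((hasDerivAt_id z).const_mul q).fun_neg
    exact h2.mul (analyticAt_theta hq hz).differentiableAt.hasDerivAt
  -- The functional equation of `θ_q` is differentiated; its logarithmic derivative produces the
  -- added `1`.
  have hd3 : (fun w => theta q (q * w)) =ᶠ[𝓝 z] fun w => -(q * w) * theta q w :=
    (eventually_ne_nhds hz).mono fun w hw => theta_q_mul hq hw
  have hd := hd1.unique (hd2.congr_of_eventuallyEq hd3)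
  change q * z * deriv (theta q) (q * z) / theta q (q * z) =
    z * deriv (theta q) z / theta q z + 1
  rw [theta_q_mul hq hz, div_add_one hθ, div_eq_div_iff (mul_ne_zero (neg_ne_zero.2
    (mul_ne_zero hq0 hz)) hθ) hθ]
  linear_combination (z * theta q z) * hd

/-- The germ of `Θ_q ^ μ`. -/
def thetaPow (q : ℂ) (μ : ℤ) : OriginGerm := ((fun z => bigTheta q z ^ μ : ℂ → ℂ) : OriginGerm)

theorem bigTheta_eq (q z : ℂ) : bigTheta q z = theta q (-q⁻¹ * z) := by
  rw [bigTheta, neg_mul, inv_mul_eq_div, neg_div]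

theorem isUnit_thetaPow {q : ℂ} (hq : 1 < ‖q‖) (μ : ℤ) : IsUnit (thetaPow q μ) := by
  refine isUnit_coe ?_
  filter_upwards [eventually_theta_ne_zero hq (neg_ne_zero.2 (inv_ne_zero (q_ne_zero hq)))]
    with z hz
  rw [bigTheta_eq]
  exact zpow_ne_zero _ hz

theorem sigma_thetaPow {q : ℂ} (hq : 1 < ‖q‖) (μ : ℤ) :
    sigma q hq (thetaPow q μ) = zmon μ * thetaPow q μ := by
  rw [thetaPow, sigma_coe]
  refine coe_eq_of_forall_ne fun z hz => ?_
  have hq0 := q_ne_zero hq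
  simp only [bigTheta_eq]
  rw [mul_left_comm, theta_q_mul hq (mul_ne_zero (neg_ne_zero.2 (inv_ne_zero hq0)) hz)]
  change _ = z ^ μ * theta q (-q⁻¹ * z) ^ μ
  rw [← mul_zpow]
  congr 2
  field_simp

theorem qCharMonomial_eq (q c : ℂ) (μ : ℤ) :
    (qCharMonomial q c μ : OriginGerm) = (qChar q c : OriginGerm) * thetaPow q μ := rfl

theorem meromorphicAt_theta_mul {q : ℂ} (hq : 1 < ‖q‖) {c z : ℂ} (hc : c ≠ 0) (hz : z ≠ 0) :
    MeromorphicAt (fun w => theta q (c * w)) z :=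
  meromorphicAt_comp_const_mul (analyticAt_theta hq (mul_ne_zero hc hz)).meromorphicAt

theorem qChar_mem_L {q : ℂ} (hq : 1 < ‖q‖) {c : ℂ} (hc : c ≠ 0) (C : ConvergentCase) :
    (qChar q c : OriginGerm) ∈ C.L :=
  coe_mem_L (fun _ hz => (analyticAt_theta hq hz).meromorphicAt.div
    (meromorphicAt_theta_mul hq (inv_ne_zero hc) hz)) C

theorem thetaPow_mem_L {q : ℂ} (hq : 1 < ‖q‖) (μ : ℤ) (C : ConvergentCase) :
    thetaPow q μ ∈ C.L :=
  coe_mem_L (fun _ hz => by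
    simp only [bigTheta_eq]
    exact (meromorphicAt_theta_mul hq (neg_ne_zero.2 (inv_ne_zero (q_ne_zero hq))) hz).zpow μ) C

theorem qLog_mem_L {q : ℂ} (hq : 1 < ‖q‖) (C : ConvergentCase) : (qLog q : OriginGerm) ∈ C.L :=
  coe_mem_L (fun z hz => ((MeromorphicAt.id z).mul (analyticAt_theta hq hz).deriv.meromorphicAt).div
    (analyticAt_theta hq hz).meromorphicAt) C

theorem convergentAlgebra_le_L {q : ℂ} (hq : 1 < ‖q‖) (C : ConvergentCase) {f : OriginGerm}
    (hf : f ∈ convergentAlgebra q C) : f ∈ C.L := by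
  refine Algebra.adjoin_induction (p := fun x _ => x ∈ C.L) ?_ ?_ ?_ ?_ hf
  · rintro x (⟨c, μ, hc, rfl⟩ | rfl)
    · rw [qCharMonomial_eq]
      exact mul_mem (qChar_mem_L hq hc C) (thetaPow_mem_L hq μ C)
    · exact qLog_mem_L hq C
  · exact fun r => K_le_L C r.2
  · exact fun x y _ _ => add_mem
  · exact fun x y _ _ => mul_mem

end

noncomputable section

open Polynomial

/-! ### The space in which solutions are found -/

/-- The falling factorials of the `q`-logarithm. -/
def qLogFalling (q : ℂ) (j : ℕ) : OriginGerm :=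
  ∏ i ∈ Finset.range j, ((qLog q : OriginGerm) - i)

theorem qLogFalling_succ (q : ℂ) (j : ℕ) :
    qLogFalling q (j + 1) = qLogFalling q j * ((qLog q : OriginGerm) - j) :=
  Finset.prod_range_succ _ _

/-- As `σ_q l_q = l_q + 1`, the operator `σ_q - 1` acts on falling factorials as the finite
difference acts on those of an integer variable, lowering the degree by one. -/
theorem sigma_qLogFalling_succ {q : ℂ} (hq : 1 < ‖q‖) (j : ℕ) :
    sigma q hq (qLogFalling q (j + 1)) =
      qLogFalling q (j + 1) + ((j + 1 : ℕ) : OriginGerm) * qLogFalling q j := by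
  have h : sigma q hq (qLogFalling q (j + 1)) = ((qLog q : OriginGerm) + 1) * qLogFalling q j := by
    rw [qLogFalling, map_prod, Finset.prod_range_succ', mul_comm, qLogFalling]
    simp only [map_sub, sigma_qLog, map_natCast]
    congr 1
    · simp
    · refine Finset.prod_congr rfl fun i _ => ?_
      push_cast
      ring
  rw [h, qLogFalling_succ]
  push_cast
  ring

/-- The `K`-span of the products of a `q`-character and a polynomial in the `q`-logarithm. -/
def solutionSpace (q : ℂ) (C : ConvergentCase) : Submodule C.K OriginGerm :=
  Submodule.span C.K {g | ∃ (d : ℂ) (j : ℕ), d ≠ 0 ∧ g = (qChar q d : OriginGerm) * qLogFalling q j}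

theorem mul_mem_solutionSpace {q : ℂ} {C : ConvergentCase} {v : OriginGerm} (hv : v ∈ C.K) {d : ℂ}
    (hd : d ≠ 0) (j : ℕ) :
    v * ((qChar q d : OriginGerm) * qLogFalling q j) ∈ solutionSpace q C :=
  Submodule.smul_mem _ (⟨v, hv⟩ : C.K) (Submodule.subset_span ⟨d, j, hd, rfl⟩)

theorem thetaPow_mul_mem_convergentAlgebra {q : ℂ} {C : ConvergentCase} (μ : ℤ) {f : OriginGerm}
    (hf : f ∈ solutionSpace q C) : thetaPow q μ * f ∈ convergentAlgebra q C := by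
  have hl : ∀ j, qLogFalling q j ∈ convergentAlgebra q C := fun j => prod_mem fun i _ =>
    sub_mem (Algebra.subset_adjoin (Or.inr rfl)) (natCast_mem _ i)
  refine Submodule.span_induction (p := fun f _ => thetaPow q μ * f ∈ convergentAlgebra q C)
    ?_ ?_ ?_ ?_ hf
  · rintro _ ⟨d, j, hd, rfl⟩
    rw [← mul_assoc, mul_comm (thetaPow q μ), ← qCharMonomial_eq]
    exact mul_mem (Algebra.subset_adjoin (Or.inl ⟨d, μ, hd, rfl⟩)) (hl j)
  · rw [mul_zero]
    exact zero_mem _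
  · intro x y _ _ hx hy
    rw [mul_add]
    exact add_mem hx hy
  · intro k x _ hx
    rw [mul_smul_comm]
    exact Subalgebra.smul_mem _ hx k

/-- The ansatz `h = u y E D`, with `E` the character and `D` the falling factorial, turns the
equation into `d σy - c y = v / σu`, up to a term in `σD - D`, which has lower degree in `l_q`. The
caller removes that term by induction on `j`. -/
theorem exists_sigma_sub_eq_aux {q : ℂ} (hq : 1 < ‖q‖) {C : ConvergentCase} {c : ℂ} (hc : c ≠ 0)
    {u a : OriginGerm} (hu : u ∈ C.K) (hu0 : IsUnit u) (ha : a * u = constGerm c * sigma q hq u)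
    {d : ℂ} (hd : d ≠ 0) (j : ℕ) {v : OriginGerm} (hv : v ∈ C.K) :
    ∃ h ∈ solutionSpace q C, ∃ w ∈ C.K, sigma q hq h - a * h =
      v * ((qChar q d : OriginGerm) * qLogFalling q j) +
        w * ((qChar q d : OriginGerm) * (sigma q hq (qLogFalling q j) - qLogFalling q j)) := by
  have hσu := sigma_mem_K q hq C hu
  obtain ⟨y, hy, l, m, hylm, hlm⟩ := exists_firstOrder q hq (c := c) hd
    (mul_mem hv (inv_mem_K hσu))
  set E : OriginGerm := (qChar q d : OriginGerm) with hE
  have hσE : sigma q hq E = constGerm d * E := sigma_qChar hq hd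
  have hinv := mul_inv_of_isUnit (hu0.map (sigma q hq))
  -- Since `d q^m = c` when `l ≠ 0`, applying `σ_q - a` to `z^m u E` times the next falling
  -- factorial gives `c (j + 1) z^m σ(u) E D`. This `k` makes it cancel the obstruction `l z^m`.
  set k : ℂ := l / c / ((j + 1 : ℕ) : ℂ) with hk
  have hj : ((j + 1 : ℕ) : ℂ) ≠ 0 := Nat.cast_ne_zero.2 j.succ_ne_zero
  have hkl : constGerm k * constGerm c * ((j + 1 : ℕ) : OriginGerm) = constGerm l := by
    rw [← map_natCast constGerm, ← map_mul, ← map_mul, hk]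
    congr 1
    field_simp
  have hdc : constGerm k * (constGerm d * constGerm (q ^ m)) = constGerm k * constGerm c := by
    rcases hlm with rfl | h
    · simp [hk]
    · rw [← map_mul constGerm d, h]
  refine ⟨u * y * (E * qLogFalling q j) +
      constGerm k * zmon m * u * (E * qLogFalling q (j + 1)),
    add_mem (mul_mem_solutionSpace (mul_mem hu hy) hd _) (mul_mem_solutionSpace
      (mul_mem (mul_mem (constGerm_mem_K _ _) (zmon_mem_K _ _)) hu) hd _),
    constGerm d * sigma q hq u * sigma q hq y,
    mul_mem (mul_mem (constGerm_mem_K _ _) hσu) (sigma_mem_K q hq C hy), ?_⟩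
  simp only [map_add, map_mul, sigma_constGerm, sigma_zmon, hσE, sigma_qLogFalling_succ]
  set D := qLogFalling q j
  set D' := qLogFalling q (j + 1)
  set su := sigma q hq u
  linear_combination (su * E * D) * hylm - (y * E * D + constGerm k * zmon m * E * D') * ha
    + (zmon m * su * E * (D' + ((j + 1 : ℕ) : OriginGerm) * D)) * hdc
    + (zmon m * su * E * D) * hkl + (v * E * D) * hinv

/-- The operator `σ_q - a`, with `a = c σ_q(u) / u`, is surjective on the solution space. -/
theorem exists_sigma_sub_eq {q : ℂ} (hq : 1 < ‖q‖) {C : ConvergentCase} {c : ℂ} (hc : c ≠ 0)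
    {u a : OriginGerm} (hu : u ∈ C.K) (hu0 : IsUnit u) (ha : a * u = constGerm c * sigma q hq u)
    {g : OriginGerm} (hg : g ∈ solutionSpace q C) :
    ∃ h ∈ solutionSpace q C, sigma q hq h - a * h = g := by
  have core : ∀ d ≠ 0, ∀ j, ∀ v ∈ C.K, ∃ h ∈ solutionSpace q C,
      sigma q hq h - a * h = v * ((qChar q d : OriginGerm) * qLogFalling q j) := by
    intro d hd j
    induction j with
    | zero =>
      intro v hv
      obtain ⟨h, hh, w, -, heq⟩ := exists_sigma_sub_eq_aux hq hc hu hu0 ha hd 0 hv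
      refine ⟨h, hh, heq.trans ?_⟩
      simp [qLogFalling]
    | succ j ih =>
      intro v hv
      obtain ⟨h, hh, w, hw, heq⟩ := exists_sigma_sub_eq_aux hq hc hu hu0 ha hd (j + 1) hv
      obtain ⟨h', hh', heq'⟩ := ih (w * ((j + 1 : ℕ) : OriginGerm)) (mul_mem hw (natCast_mem _ _))
      refine ⟨h - h', sub_mem hh hh', ?_⟩
      rw [sigma_qLogFalling_succ, add_sub_cancel_left] at heq
      rw [map_sub]
      linear_combination heq - heq'
  -- The operator `σ_q - a` is not `K`-linear, so the induction over the span has to carry an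
  -- arbitrary factor `v`.
  have key : ∀ v ∈ C.K, ∃ h ∈ solutionSpace q C, sigma q hq h - a * h = v * g := by
    refine Submodule.span_induction (p := fun g _ => ∀ v ∈ C.K, ∃ h ∈ solutionSpace q C,
      sigma q hq h - a * h = v * g) ?_ ?_ ?_ ?_ hg
    · rintro _ ⟨d, j, hd, rfl⟩
      exact core d hd j
    · exact fun v _ => ⟨0, zero_mem _, by simp⟩
    · intro x y _ _ hx hy v hv
      obtain ⟨h, hh, heq⟩ := hx v hv
      obtain ⟨h', hh', heq'⟩ := hy v hv
      exact ⟨h + h', add_mem hh hh', by rw [map_add]; linear_combination heq + heq'⟩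
    · intro k x _ hx v hv
      obtain ⟨h, hh, heq⟩ := hx (v * k) (mul_mem hv k.2)
      exact ⟨h, hh, by rw [heq, mul_assoc]; rfl⟩
  simpa using key 1 (one_mem _)

/-! ### Right division by an operator of order one -/

theorem sigma_iterate_mem_K {q : ℂ} (hq : 1 < ‖q‖) {C : ConvergentCase} {x : OriginGerm}
    (hx : x ∈ C.K) (n : ℕ) : (sigma q hq)^[n] x ∈ C.K := by
  induction n with
  | zero => exact hx
  | succ n ih =>
    rw [Function.iterate_succ_apply']
    exact sigma_mem_K q hq C ih

/-- The leading term is removed by `b σ^(n+1) = b σ^n (σ - a) + b σ^n(a) σ^n`. Since `σ^n(a)` and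
`a` have the same value at `0`, the symbols undergo ordinary division by `X - a(0)`. -/
theorem exists_right_division (q : ℂ) (hq : 1 < ‖q‖) {C : ConvergentCase} {a : analyticGerms}
    (ha : (a : OriginGerm) ∈ C.K) (n : ℕ) : ∀ p : analyticGerms[X], p.natDegree ≤ n →
      (∀ j, (p.coeff j : OriginGerm) ∈ C.K) → ∃ (r : analyticGerms[X]) (R : analyticGerms),
        r.natDegree ≤ n - 1 ∧ (∀ j, (r.coeff j : OriginGerm) ∈ C.K) ∧
        (∀ f, skewEval q hq p f = skewEval q hq r (sigma q hq f - a * f) + R * f) ∧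
        p.map residue = r.map residue * (X - Polynomial.C (residue a)) +
          Polynomial.C (residue R) := by
  have hmon : ∀ (k : ℕ) (b : analyticGerms), (b : OriginGerm) ∈ C.K →
      ∀ j, ((monomial k b).coeff j : OriginGerm) ∈ C.K := fun k b hb j => by
    rw [coeff_monomial]
    split_ifs
    exacts [hb, zero_mem _]
  induction n with
  | zero =>
    intro p hp _
    obtain ⟨b, rfl⟩ := natDegree_eq_zero.1 (Nat.le_zero.1 hp)
    refine ⟨0, b, by simp, fun j => by simp [zero_mem], fun f => ?_, by simp⟩
    rw [skewEval_zero, zero_add, ← monomial_zero_left, skewEval_monomial]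
    rfl
  | succ n ih =>
    intro p hp hpK
    set b := p.coeff (n + 1) with hb
    set s := (sigmaAnalytic q hq)^[n] a with hs
    have hscoe : (s : OriginGerm) = (sigma q hq)^[n] (a : OriginGerm) := by
      rw [hs]
      exact Function.Semiconj.iterate_right (f := ((↑) : analyticGerms → OriginGerm))
        (fun x => rfl) n a
    have hsK : (s : OriginGerm) ∈ C.K := by
      rw [hscoe]
      exact sigma_iterate_mem_K hq ha n
    have hsres : residue s = residue a := by
      rw [hs]
      exact Function.Semiconj.iterate_right (f := residue) (ga := sigmaAnalytic q hq) (gb := id)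
        (fun x => residue_sigmaAnalytic q hq x) n a |>.trans (by simp)
    obtain ⟨r, R, hr, hrK, hreval, hrres⟩ := ih (p - monomial (n + 1) b + monomial n (b * s))
      (by
        refine natDegree_le_iff_coeff_eq_zero.2 fun k hk => ?_
        rw [coeff_add, coeff_sub, coeff_monomial, coeff_monomial, if_neg hk.ne, add_zero]
        rcases (Nat.succ_le_of_lt hk).eq_or_lt with h | h
        · rw [if_pos h, hb, ← h, sub_self]
        · rw [if_neg h.ne, natDegree_le_iff_coeff_eq_zero.1 hp k h, sub_zero])
      (fun j => by
        rw [coeff_add, coeff_sub]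
        exact add_mem (sub_mem (hpK j) (hmon _ _ (hpK _) j))
          (hmon _ _ (mul_mem (hpK _) hsK) j))
    refine ⟨r + monomial n b, R, ?_, fun j => ?_, fun f => ?_, ?_⟩
    · exact natDegree_add_le_of_degree_le (hr.trans (by omega))
        ((natDegree_monomial_le _).trans (by omega))
    · rw [coeff_add]
      exact add_mem (hrK j) (hmon _ _ (hpK _) j)
    · have h := hreval f
      have hp' : p = (p - monomial (n + 1) b) + monomial (n + 1) b := by ring
      have h1 : skewEval q hq p f = skewEval q hq (p - monomial (n + 1) b) f +
          b * (sigma q hq)^[n + 1] f := by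
        conv_lhs => rw [hp']
        rw [skewEval_add, skewEval_monomial]
      rw [skewEval_add, skewEval_monomial] at h
      rw [h1, skewEval_add, skewEval_monomial, iterate_map_sub, iterate_map_mul, ← hscoe,
        ← Function.iterate_succ_apply]
      push_cast at h
      linear_combination h
    · rw [Polynomial.map_add, Polynomial.map_sub, map_monomial, map_monomial, map_mul, hsres]
        at hrres
      rw [Polynomial.map_add, map_monomial]
      have h2 : monomial n (residue b) * (X - Polynomial.C (residue a)) =
          monomial (n + 1) (residue b) - monomial n (residue b * residue a) := by
        rw [mul_sub, monomial_mul_X, monomial_mul_C]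
      linear_combination hrres - h2

/-! ### Solutions attached to the nonzero exponents -/

theorem exists_root_norm_max {χ : ℂ[X]} (h : 0 < χ.natDegree) :
    ∃ c, χ.IsRoot c ∧ ∀ c', χ.IsRoot c' → ‖c'‖ ≤ ‖c‖ := by
  have h0 : χ ≠ 0 := fun h0 => by simp [h0] at h
  obtain ⟨c₀, hc₀⟩ := IsAlgClosed.exists_root χ (natDegree_pos_iff_degree_pos.1 h).ne'
  obtain ⟨c, hc, hmax⟩ := χ.roots.toFinset.exists_max_image norm
    ⟨c₀, by simpa [h0] using hc₀⟩
  exact ⟨c, by simpa [h0] using hc, fun c' hc' => hmax c' (by simpa [h0] using hc')⟩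

/-- An operator whose symbol at `0` has `r` nonzero roots has `r` independent solutions. -/
theorem exists_independent_solutions (q : ℂ) (hq : 1 < ‖q‖) (C : ConvergentCase) (s r : ℕ) :
    ∀ (p : analyticGerms[X]) (χ : ℂ[X]), p.natDegree ≤ s + r →
      (∀ j, (p.coeff j : OriginGerm) ∈ C.K) → p.map residue = X ^ s * χ → χ.natDegree = r →
      χ.coeff 0 ≠ 0 → ∃ f : Fin r → OriginGerm, (∀ i, f i ∈ solutionSpace q C) ∧
        (∀ i, skewEval q hq p (f i) = 0) ∧ LinearIndependent (constants q hq C) f := by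
  have hq0 := q_ne_zero hq
  induction r with
  | zero =>
    exact fun p χ _ _ _ _ _ => ⟨Fin.elim0, fun i => i.elim0, fun i => i.elim0,
      linearIndependent_empty_type⟩
  | succ r ih =>
    intro p χ hp hpK hpχ hχ hχ0
    -- Maximal modulus excludes every `c q^(m+1)` as a root, which is the nonresonance required for
    -- the series `u`.
    obtain ⟨c, hc, hcmax⟩ := exists_root_norm_max (χ := χ) (by omega)
    have hc0 : c ≠ 0 := fun h => hχ0 (by subst h; rw [coeff_zero_eq_eval_zero]; exact hc)
    have hne : ∀ m : ℕ, χ.eval (c * q ^ (m + 1)) ≠ 0 := fun m h => by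
      have h1 := hcmax _ h
      rw [norm_mul, norm_pow] at h1
      have h2 : 1 < ‖q‖ ^ (m + 1) := one_lt_pow₀ hq m.succ_ne_zero
      have h3 := norm_pos_iff.2 hc0
      nlinarith
    have hlead : residue ((p.comp (Polynomial.C (constAnalytic c) * X)).coeff (s + (r + 1))) ≠ 0 := by
      rw [comp_C_mul_X_coeff, map_mul, map_pow, residue_constAnalytic, ← coeff_map, hpχ, add_comm s,
        coeff_X_pow_mul, ← hχ]
      refine mul_ne_zero (leadingCoeff_ne_zero.2 fun h => ?_) (pow_ne_zero _ hc0)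
      simp [h] at hχ0
    obtain ⟨u, hu1, hu⟩ := exists_skewEval_eq_zero q hq
      (natDegree_comp_C_mul_X_le hp (constAnalytic c)) hlead
      (by rw [map_residue_comp, hpχ, eval_comp]; simp [hc.eq_zero])
      (fun m => by
        rw [map_residue_comp, hpχ, eval_comp]
        simpa [hc0, hq0] using hne m)
    have huK : (u : OriginGerm) ∈ C.K := by
      refine mem_K_of_skewEval_mem q hq (natDegree_comp_C_mul_X_le hp (constAnalytic c))
        (fun j => ?_) (fun h => hlead (by rw [h, map_zero])) (analyticGerms_le_germK u.2)
        (by rw [hu]; exact zero_mem _)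
      rw [comp_C_mul_X_coeff]
      exact mul_mem (hpK j) (pow_mem (constGerm_mem_K c C) j)
    have huU : IsUnit u := isUnit_of_residue_ne_zero (by rw [hu1]; exact one_ne_zero)
    have huU' : IsUnit (u : OriginGerm) := huU.map analyticGerms.subtype
    obtain ⟨w, hw⟩ := huU.exists_right_inv
    have hw' : (u : OriginGerm) * w = 1 := congrArg Subtype.val hw
    have hwK : (w : OriginGerm) ∈ C.K := by
      have : (w : OriginGerm) = (u : OriginGerm)⁻¹ :=
        huU'.mul_left_cancel (hw'.trans (mul_inv_of_isUnit huU').symm)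
      rw [this]
      exact inv_mem_K huK
    -- The coefficient `c σ(u) / u` for which `σ_q - a` annihilates `e_{q,c} u`. Its value at `0` is
    -- `c`, because `u` is `1` there.
    set a : analyticGerms := constAnalytic c * sigmaAnalytic q hq u * w with ha
    have hacoe : (a : OriginGerm) = constGerm c * sigma q hq u * w := rfl
    have hau : (a : OriginGerm) * u = constGerm c * sigma q hq u := by
      rw [hacoe, mul_assoc, mul_comm (w : OriginGerm), hw', mul_one]
    have hares : residue a = c := by
      have h1 := congrArg residue hw
      rw [map_mul, hu1, one_mul, map_one] at h1
      rw [ha, map_mul, map_mul, residue_constAnalytic, residue_sigmaAnalytic, hu1, h1, mul_one,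
        mul_one]
    obtain ⟨p', R, hp', hp'K, heval, hres⟩ := exists_right_division q hq (a := a)
      (mul_mem (mul_mem (constGerm_mem_K c C) (sigma_mem_K q hq C huK)) hwK) _ p hp hpK
    set f₀ : OriginGerm := (qChar q c : OriginGerm) * u with hf₀
    have hf₀U : IsUnit f₀ := (isUnit_qChar hq hc0).mul huU'
    have hσf₀ : sigma q hq f₀ - a * f₀ = 0 := by
      rw [hf₀, map_mul, sigma_qChar hq hc0]
      linear_combination -(qChar q c : OriginGerm) * hau
    have hpf₀ : skewEval q hq p f₀ = 0 := by
      rw [hf₀, skewEval_mul q hq (sigma_qChar hq hc0), hu, mul_zero]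
    -- Evaluating the division at `f₀` leaves `R f₀ = 0`, and `f₀` is a unit.
    have hR : R = 0 := by
      have h1 := heval f₀
      rw [hpf₀, hσf₀] at h1
      have h2 : skewEval q hq p' 0 = 0 := by
        simpa using skewEval_map_add q hq p' 0 0
      rw [h2, zero_add] at h1
      exact Subtype.ext (hf₀U.mul_left_eq_zero.1 h1.symm)
    subst hR
    obtain ⟨χ', rfl⟩ := dvd_iff_isRoot.2 hc
    have hχ'0 : χ'.coeff 0 ≠ 0 := fun h => hχ0 (by simp [mul_coeff_zero, h])
    have hχ'deg : χ'.natDegree = r := by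
      rw [natDegree_mul (X_sub_C_ne_zero c) (fun h => hχ'0 (by simp [h])), natDegree_X_sub_C] at hχ
      omega
    have hp'χ : p'.map residue = X ^ s * χ' := by
      rw [hpχ, map_zero, map_zero, add_zero, hares] at hres
      refine mul_right_cancel₀ (X_sub_C_ne_zero c) ?_
      rw [← hres]
      ring
    obtain ⟨g, hgV, hg, hgind⟩ := ih p' χ' (hp'.trans (by omega)) hp'K hp'χ hχ'deg hχ'0
    choose h hhV hh using fun i => exists_sigma_sub_eq hq hc0 huK huU' hau (hgV i)
    refine ⟨Fin.cons f₀ h, fun i => ?_, fun i => ?_, ?_⟩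
    · refine Fin.cases ?_ (fun i => ?_) i
      · have := mul_mem_solutionSpace (q := q) huK hc0 0
        simpa [qLogFalling, hf₀, mul_comm] using this
      · exact hhV i
    · refine Fin.cases ?_ (fun i => ?_) i
      · exact hpf₀
      · rw [Fin.cons_succ, heval, hh, hg]
        simp
    · rw [Fintype.linearIndependent_iff] at hgind ⊢
      intro x hx
      have hσx : ∀ i, sigma q hq (x i : OriginGerm) = x i := fun i => (x i).2.2
      rw [Fin.sum_univ_succ] at hx
      simp only [Fin.cons_zero, Fin.cons_succ, Subring.smul_def, smul_eq_mul] at hx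
      -- Constants commute with `σ_q`, so `σ_q - a` turns the relation into one among the `g i`, the
      -- term in `f₀` being killed.
      have h1 : ∑ i : Fin r, (x i.succ : OriginGerm) * g i = 0 := by
        have h2 := congrArg (fun y => sigma q hq y - a * y) hx
        simp only [map_add, map_sum, map_mul, hσx, map_zero, mul_zero, sub_zero, mul_add,
          Finset.mul_sum] at h2
        have h3 : ∑ i : Fin r, (x i.succ : OriginGerm) * g i =
            ∑ i : Fin r, (x i.succ : OriginGerm) * sigma q hq (h i) -
              ∑ i : Fin r, (a : OriginGerm) * (x i.succ * h i) := by
          rw [← Finset.sum_sub_distrib]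
          refine Finset.sum_congr rfl fun i _ => ?_
          rw [← hh i]
          ring
        rw [h3]
        linear_combination h2 - (x 0 : OriginGerm) * hσf₀
      have h4 := hgind (fun i => x i.succ) (by simpa [Subring.smul_def] using h1)
      have h5 : x 0 = 0 := by
        simp only [h4, ZeroMemClass.coe_zero, zero_mul, Finset.sum_const_zero, add_zero] at hx
        exact Subtype.ext (hf₀U.mul_left_eq_zero.1 hx)
      exact fun i => Fin.cases h5 h4 i

end

noncomputable section

/-! ### The Newton polygon -/

section NewtonPolygon

variable {n : ℕ} {a : Fin (n + 1) → OriginGerm}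

/-- Half-planes are convex, so a linear inequality on the polygon need only be checked at the
generating integral points. -/
theorem le_of_mem_newtonPolygon {s t c : ℝ}
    (h : ∀ (i : Fin (n + 1)) (j : ℤ), v₀ (a i) ≤ (j : WithTop ℤ) → c ≤ s * j + t * (i : ℕ))
    {p : ℝ × ℝ} (hp : p ∈ newtonPolygon a) : c ≤ s * p.2 + t * p.1 := by
  have hconv : Convex ℝ {p : ℝ × ℝ | c ≤ s * p.2 + t * p.1} :=
    convex_halfSpace_ge (f := fun p : ℝ × ℝ => s * p.2 + t * p.1)
      ⟨fun x y => by simp only [Prod.fst_add, Prod.snd_add]; ring,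
        fun k x => by simp only [Prod.smul_fst, Prod.smul_snd, smul_eq_mul]; ring⟩ c
  refine convexHull_min ?_ hconv hp
  rintro _ ⟨i, j, hij, rfl⟩
  exact h i j hij

theorem fst_mem_Icc_of_mem_newtonPolygon {p : ℝ × ℝ} (hp : p ∈ newtonPolygon a) :
    0 ≤ p.1 ∧ p.1 ≤ n := by
  constructor
  · simpa using le_of_mem_newtonPolygon (s := 0) (t := 1) (c := 0) (fun i j _ => by simp) hp
  · have := le_of_mem_newtonPolygon (s := 0) (t := -1) (c := -n) (fun i j _ => by
      have : ((i : ℕ) : ℝ) ≤ n := Nat.cast_le.2 i.is_le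
      linarith) hp
    linarith

theorem vertex_mem_newtonPolygon {i : Fin (n + 1)} {k : ℤ} (h : v₀ (a i) = k) :
    (((i : ℕ) : ℝ), (k : ℝ)) ∈ newtonPolygon a :=
  subset_convexHull ℝ _ ⟨i, k, h.le, rfl⟩

theorem isBounded_fst_lowerFace (μ : ℚ) :
    Bornology.IsBounded (Prod.fst '' lowerFace (newtonPolygon a) μ) := by
  refine (Metric.isBounded_Icc (0 : ℝ) n).subset ?_
  rintro _ ⟨p, hp, rfl⟩
  exact fst_mem_Icc_of_mem_newtonPolygon hp.1

/-- Two vertices on the supporting line of slope `μ` bound `r_P(μ)` from below. -/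
theorem sub_le_newtonFunction {μ : ℚ} {i₁ i₂ : Fin (n + 1)} {k₁ k₂ : ℤ} (h₁ : v₀ (a i₁) = k₁)
    (h₂ : v₀ (a i₂) = k₂) (heq : (k₁ : ℚ) - μ * (i₁ : ℕ) = k₂ - μ * (i₂ : ℕ))
    (hmin : ∀ (i : Fin (n + 1)) (j : ℤ), v₀ (a i) ≤ (j : WithTop ℤ) →
      (k₁ : ℚ) - μ * (i₁ : ℕ) ≤ j - μ * (i : ℕ)) :
    (i₂ : ℕ) - (i₁ : ℕ) ≤ newtonFunction a μ := by
  have heq' : (k₁ : ℝ) - μ * (i₁ : ℕ) = k₂ - μ * (i₂ : ℕ) := by exact_mod_cast heq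
  have hN : ∀ p ∈ newtonPolygon a, (k₁ : ℝ) - μ * (i₁ : ℕ) ≤ p.2 - μ * p.1 := fun p hp => by
    have := le_of_mem_newtonPolygon (s := 1) (t := -μ) (c := (k₁ : ℝ) - μ * (i₁ : ℕ))
      (fun i j hij => by
        have h : (k₁ : ℝ) - μ * (i₁ : ℕ) ≤ j - μ * (i : ℕ) := by exact_mod_cast hmin i j hij
        linarith) hp
    linarith
  have hm₁ : ((i₁ : ℕ) : ℝ) ∈ Prod.fst '' lowerFace (newtonPolygon a) μ :=
    ⟨_, ⟨vertex_mem_newtonPolygon h₁, hN⟩, rfl⟩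
  have hm₂ : ((i₂ : ℕ) : ℝ) ∈ Prod.fst '' lowerFace (newtonPolygon a) μ :=
    ⟨_, ⟨vertex_mem_newtonPolygon h₂, fun p hp => heq' ▸ hN p hp⟩, rfl⟩
  refine Nat.le_floor ?_
  rcases le_total (i₂ : ℕ) (i₁ : ℕ) with h | h
  · rw [Nat.sub_eq_zero_of_le h, Nat.cast_zero]
    exact Metric.diam_nonneg
  · rw [Nat.cast_sub h]
    refine (le_abs_self _).trans ?_
    rw [← Real.dist_eq]
    exact Metric.dist_le_diam_of_mem (isBounded_fst_lowerFace μ) hm₂ hm₁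

/-- If the supporting line of integral slope `μ` meets no vertex beyond the abscissa `i₂`, then
`r_P(μ) ≤ i₂`. -/
theorem newtonFunction_le {μ : ℤ} {i₂ : Fin (n + 1)} {k : ℤ} (h₂ : v₀ (a i₂) = k)
    (hmin : ∀ (i : Fin (n + 1)) (j : ℤ), v₀ (a i) ≤ (j : WithTop ℤ) →
      k - μ * (i₂ : ℕ) ≤ j - μ * (i : ℕ) ∧ (i₂ < i → k - μ * (i₂ : ℕ) < j - μ * (i : ℕ))) :
    newtonFunction a μ ≤ (i₂ : ℕ) := by
  have hupper : ∀ p ∈ lowerFace (newtonPolygon a) μ, p.1 ≤ (i₂ : ℕ) := by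
    intro p hp
    have h1 := hp.2 _ (vertex_mem_newtonPolygon h₂)
    have hn : (0 : ℝ) < n + 1 := by positivity
    -- By integrality, points beyond `i₂` lie at height at least `1` above the line. It can
    -- therefore be tilted about the vertex at `i₂` to slope `μ + 1/(n+1)` and still bound the
    -- polygon from below, which excludes abscissas beyond `i₂` from the face.
    have h2 := le_of_mem_newtonPolygon (s := 1) (t := -μ - 1 / (n + 1))
      (c := (k : ℝ) - μ * (i₂ : ℕ) - (i₂ : ℕ) / (n + 1)) (fun i j hij => by
        obtain ⟨h3, h4⟩ := hmin i j hij
        have h5 : ((i : ℕ) : ℝ) / (n + 1) - (i₂ : ℕ) / (n + 1) ≤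
            (j - μ * (i : ℕ)) - (k - μ * (i₂ : ℕ)) := by
          rw [← sub_div]
          rcases lt_or_ge i₂ i with hi | hi
          · have h6 : (k : ℝ) - μ * (i₂ : ℕ) + 1 ≤ j - μ * (i : ℕ) := by exact_mod_cast h4 hi
            have h7 : (((i : ℕ) : ℝ) - (i₂ : ℕ)) / (n + 1) ≤ 1 := by
              rw [div_le_one hn]
              have : ((i : ℕ) : ℝ) ≤ n := Nat.cast_le.2 i.is_le
              have : (0 : ℝ) ≤ (i₂ : ℕ) := Nat.cast_nonneg _
              linarith
            linarith
          · have h6 : (k : ℝ) - μ * (i₂ : ℕ) ≤ j - μ * (i : ℕ) := by exact_mod_cast h3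
            have h7 : (((i : ℕ) : ℝ) - (i₂ : ℕ)) / (n + 1) ≤ 0 := by
              refine div_nonpos_of_nonpos_of_nonneg (sub_nonpos.2 (Nat.cast_le.2 hi)) hn.le
            linarith
        have h8 : (-(μ : ℝ) - 1 / (n + 1)) * (i : ℕ) = -(μ * (i : ℕ)) - (i : ℕ) / (n + 1) := by
          ring
        rw [h8]
        linarith) hp.1
    simp only [Rat.cast_intCast] at h1
    have h3 : (-(μ : ℝ) - 1 / (n + 1)) * p.1 = -(μ * p.1) - p.1 / (n + 1) := by ring
    rw [h3] at h2
    have h4 : p.1 / (n + 1) ≤ (i₂ : ℕ) / ((n : ℝ) + 1) := by linarith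
    exact (div_le_div_iff_of_pos_right hn).1 h4
  refine Nat.floor_le_of_le (Metric.diam_le_of_forall_dist_le (Nat.cast_nonneg _) ?_)
  rintro _ ⟨p, hp, rfl⟩ _ ⟨p', hp', rfl⟩
  have h1 := hupper p hp
  have h2 := hupper p' hp'
  have h3 := (fst_mem_Icc_of_mem_newtonPolygon hp.1).1
  have h4 := (fst_mem_Icc_of_mem_newtonPolygon hp'.1).1
  rw [Real.dist_eq, abs_le]
  constructor <;> linarith

/-- The Newton polygon lies above its first edge. -/
theorem exists_first_edge (h0 : v₀ (a 0) ≠ ⊤) {μ : ℤ} (hμ : (μ : ℚ) ∈ lowerBounds (slopes a)) :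
    ∃ (d : ℤ) (r : Fin (n + 1)), (r : ℕ) = newtonFunction a μ ∧
      v₀ (a 0) = d ∧ v₀ (a r) = ((d + μ * (r : ℕ) : ℤ) : WithTop ℤ) ∧
      ∀ i : Fin (n + 1), ((d + μ * (i : ℕ) : ℤ) : WithTop ℤ) ≤ v₀ (a i) ∧
        (r < i → ((d + μ * (i : ℕ) : ℤ) : WithTop ℤ) < v₀ (a i)) := by
  classical
  -- The default value `0` for vanishing coefficients is harmless: `κ` is only used on `I`, where
  -- the valuation is finite.
  set κ : Fin (n + 1) → ℤ := fun i => (v₀ (a i)).untopD 0 with hκ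
  set I : Finset (Fin (n + 1)) := Finset.univ.filter fun i => v₀ (a i) ≠ ⊤ with hI
  have hκI : ∀ i ∈ I, v₀ (a i) = κ i := fun i hi => by
    rw [hI, Finset.mem_filter] at hi
    obtain ⟨k, hk⟩ := WithTop.ne_top_iff_exists.1 hi.2
    simp [hκ, ← hk]
  have hle : ∀ i (j : ℤ), v₀ (a i) ≤ (j : WithTop ℤ) → i ∈ I ∧ κ i ≤ j := fun i j hij => by
    have hi : i ∈ I := by
      rw [hI, Finset.mem_filter]
      exact ⟨Finset.mem_univ _, ne_top_of_le_ne_top WithTop.coe_ne_top hij⟩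
    rw [hκI i hi] at hij
    exact ⟨hi, WithTop.coe_le_coe.1 hij⟩
  have h0I : (0 : Fin (n + 1)) ∈ I := by simpa [hI] using h0
  have hmin0 : ∀ i ∈ I, κ 0 ≤ κ i - μ * (i : ℕ) := by
    by_contra! hcon
    obtain ⟨i₁, hi₁, hlt⟩ := hcon
    have hi₁0 : i₁ ≠ 0 := by
      rintro rfl
      simp at hlt
    -- If some vertex lay below the line of slope `μ` through the leftmost vertex, the least slope
    -- `ν` from that vertex would be a slope of the polygon smaller than `μ`.
    obtain ⟨i, hi, himin⟩ := (I.erase 0).exists_min_image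
      (fun i => ((κ i : ℚ) - κ 0) / (i : ℕ)) ⟨i₁, Finset.mem_erase.2 ⟨hi₁0, hi₁⟩⟩
    have hipos : ∀ i' ∈ I.erase 0, (0 : ℚ) < (i' : ℕ) := fun i' hi' => by
      have := (Finset.mem_erase.1 hi').1
      exact Nat.cast_pos.2 (Nat.pos_of_ne_zero fun h => this (Fin.ext h))
    set ν : ℚ := ((κ i : ℚ) - κ 0) / (i : ℕ) with hν
    have hνi : ν * (i : ℕ) = κ i - κ 0 := div_mul_cancel₀ _ (hipos i hi).ne'
    have hslope : ν ∈ slopes a := by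
      have h1 := sub_le_newtonFunction (a := a) (μ := ν) (hκI 0 h0I)
        (hκI i (Finset.mem_erase.1 hi).2) (by rw [hνi]; simp) (fun i' j hij => by
          obtain ⟨hi'I, hi'j⟩ := hle i' j hij
          have h2 : (κ i' : ℚ) ≤ j := Int.cast_le.2 hi'j
          by_cases h : i' = 0
          · subst h
            simpa using h2
          · have h3 := himin i' (Finset.mem_erase.2 ⟨h, hi'I⟩)
            rw [le_div_iff₀ (hipos i' (Finset.mem_erase.2 ⟨h, hi'I⟩))] at h3
            simp only [Fin.val_zero, Nat.cast_zero, mul_zero, sub_zero]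
            linarith)
      have h2 : 0 < (i : ℕ) := Nat.cast_pos.1 (hipos i hi)
      simp only [Fin.val_zero, Nat.sub_zero] at h1
      exact (h2.trans_le h1).ne'
    have h1 := hμ hslope
    have h2 := himin i₁ (Finset.mem_erase.2 ⟨hi₁0, hi₁⟩)
    have h3 : (μ : ℚ) ≤ ((κ i₁ : ℚ) - κ 0) / (i₁ : ℕ) := h1.trans h2
    rw [le_div_iff₀ (hipos i₁ (Finset.mem_erase.2 ⟨hi₁0, hi₁⟩))] at h3
    have h4 : ((κ i₁ : ℚ) - μ * (i₁ : ℕ)) < κ 0 := by exact_mod_cast hlt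
    linarith
  -- The indices of vertices on the first supporting line; the largest of them is the right end of
  -- the edge.
  set J : Finset (Fin (n + 1)) := I.filter fun i => κ i - μ * (i : ℕ) = κ 0 with hJ
  have h0J : (0 : Fin (n + 1)) ∈ J := by simp [hJ, h0I]
  set r := J.max' ⟨0, h0J⟩ with hr
  have hrJ := Finset.mem_filter.1 (J.max'_mem ⟨0, h0J⟩)
  rw [← hr] at hrJ
  have hlt : ∀ i ∈ I, r < i → κ 0 < κ i - μ * (i : ℕ) := fun i hi hri =>
    lt_of_le_of_ne (hmin0 i hi) fun h =>
      (J.le_max' i (Finset.mem_filter.2 ⟨hi, h.symm⟩)).not_gt hri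
  refine ⟨κ 0, r, le_antisymm ?_ ?_, hκI 0 h0I, ?_, fun i => ?_⟩
  · have h1 := sub_le_newtonFunction (a := a) (μ := μ) (hκI 0 h0I) (hκI r hrJ.1)
      (by
        have : ((κ r : ℚ) - μ * (r : ℕ)) = κ 0 := by exact_mod_cast hrJ.2
        rw [this]
        simp)
      (fun i j hij => by
        obtain ⟨hiI, hij'⟩ := hle i j hij
        have h2 : (κ 0 : ℚ) ≤ κ i - μ * (i : ℕ) := by exact_mod_cast hmin0 i hiI
        have h3 : (κ i : ℚ) ≤ j := Int.cast_le.2 hij'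
        simp only [Fin.val_zero, Nat.cast_zero, mul_zero, sub_zero]
        linarith)
    simpa using h1
  · refine newtonFunction_le (hκI r hrJ.1) fun i j hij => ?_
    obtain ⟨hiI, hij'⟩ := hle i j hij
    have h1 := hmin0 i hiI
    rw [hrJ.2]
    exact ⟨by linarith, fun h => by have := hlt i hiI h; linarith⟩
  · rw [hκI r hrJ.1, WithTop.coe_inj]
    linarith [hrJ.2]
  · by_cases hiI : i ∈ I
    · rw [hκI i hiI, WithTop.coe_le_coe, WithTop.coe_lt_coe]
      have h1 := hmin0 i hiI
      exact ⟨by linarith, fun h => by have := hlt i hiI h; linarith⟩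
    · have : v₀ (a i) = ⊤ := by simpa [hI] using hiI
      rw [this]
      exact ⟨le_top, fun _ => WithTop.coe_lt_top _⟩

end NewtonPolygon

/-! ### Reduction of the first slope to zero -/

theorem v₀_ne_top {x : OriginGerm} (hx : x ∈ ConvergentCase.germ.K) (h : x ≠ 0) : v₀ x ≠ ⊤ := by
  obtain ⟨f, hf, rfl⟩ := exists_rep_of_mem_germK hx
  rw [v₀_coe hf, Ne, meromorphicOrderAt_eq_top_iff]
  exact fun h0 => h (coe_eq_of_eventually h0)

/-- If `x = z^(m+l) g` with `g(0) ≠ 0`, the quotient `z^l g` vanishes at `0` exactly when `l > 0`.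
-/
theorem exists_eq_zmon_mul_of_le {x : OriginGerm} (hx : x ∈ ConvergentCase.germ.K) {m : ℤ}
    (hm : (m : WithTop ℤ) ≤ v₀ x) :
    ∃ y : analyticGerms, x = zmon m * y ∧ (residue y = 0 ↔ (m : WithTop ℤ) < v₀ x) := by
  obtain ⟨f, hf, rfl⟩ := exists_rep_of_mem_germK hx
  rw [v₀_coe hf] at hm ⊢
  by_cases htop : meromorphicOrderAt f 0 = ⊤
  · refine ⟨0, ?_, by simp [htop]⟩
    rw [ZeroMemClass.coe_zero, mul_zero]
    exact coe_eq_of_eventually (g := 0) (meromorphicOrderAt_eq_top_iff.1 htop)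
  · obtain ⟨k, hk⟩ := WithTop.ne_top_iff_exists.1 htop
    obtain ⟨g, hg, hg0, hfg⟩ := (meromorphicOrderAt_eq_int_iff hf).1 hk.symm
    rw [← hk] at hm ⊢
    rw [WithTop.coe_le_coe] at hm
    obtain ⟨l, rfl⟩ := Int.le.dest hm
    have han : AnalyticAt ℂ (fun z => z ^ l * g z) 0 := (analyticAt_id.pow l).mul hg
    refine ⟨analyticGerm _ han, coe_eq_of_eventually ?_, ?_⟩
    · filter_upwards [hfg, eventually_mem_nhdsWithin] with z hz hz0
      rw [hz, sub_zero, smul_eq_mul, zpow_add₀ hz0, zpow_natCast, mul_assoc]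
    · rw [residue_analyticGerm, WithTop.coe_lt_coe]
      simp [hg0, Nat.pos_iff_ne_zero]

theorem exists_sigma_iterate_thetaPow {q : ℂ} (hq : 1 < ‖q‖) (μ : ℤ) (j : ℕ) :
    ∃ k : ℂ, k ≠ 0 ∧
      (sigma q hq)^[j] (thetaPow q μ) = constGerm k * zmon (μ * j) * thetaPow q μ := by
  induction j with
  | zero => exact ⟨1, one_ne_zero, by simp⟩
  | succ j ih =>
    obtain ⟨k, hk, h⟩ := ih
    refine ⟨k * q ^ (μ * j), mul_ne_zero hk (zpow_ne_zero _ (q_ne_zero hq)), ?_⟩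
    rw [Function.iterate_succ_apply', h, map_mul, map_mul, sigma_constGerm, sigma_zmon,
      sigma_thetaPow, map_mul, Nat.cast_succ, mul_add, mul_one, zmon_add]
    ring

open Polynomial

/-- The gauge transformation by `Θ_q ^ μ`, which brings the first slope to `0`. -/
theorem exists_gauge_transform {q : ℂ} (hq : 1 < ‖q‖) {C : ConvergentCase} {n : ℕ}
    {a : Fin (n + 1) → OriginGerm} {μ d : ℤ} {r : Fin (n + 1)} {b : Fin (n + 1) → analyticGerms}
    (haK : ∀ i, a i ∈ C.K) (hab : ∀ i, a i = zmon (d + μ * (i : ℕ)) * b i)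
    (hb0 : residue (b 0) ≠ 0) (hbr : residue (b r) ≠ 0) (hb : ∀ i, r < i → residue (b i) = 0) :
    ∃ (p : analyticGerms[X]) (χ : ℂ[X]), p.natDegree ≤ (n - r) + r ∧
      (∀ j, (p.coeff j : OriginGerm) ∈ C.K) ∧ p.map residue = X ^ (n - r : ℕ) * χ ∧
      χ.natDegree = r ∧ χ.coeff 0 ≠ 0 ∧ ∀ g, applyOp q hq a (thetaPow q μ * g) =
        zmon (d + μ * n) * thetaPow q μ * skewEval q hq p g := by
  have hrn : (r : ℕ) ≤ n := r.is_le
  choose k hk hkσ using exists_sigma_iterate_thetaPow hq μ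
  have hbK : ∀ i, (b i : OriginGerm) ∈ C.K := fun i => by
    have : (b i : OriginGerm) = zmon (-(d + μ * (i : ℕ))) * a i := by
      rw [hab, ← mul_assoc, mul_comm (zmon _) (zmon _), zmon_mul_neg, one_mul]
    rw [this]
    exact mul_mem (zmon_mem_K _ _) (haK i)
  set p : analyticGerms[X] :=
    ∑ i : Fin (n + 1), monomial (n - (i : ℕ)) (constAnalytic (k (n - (i : ℕ))) * b i) with hp
  have hcoeff : ∀ i : Fin (n + 1),
      p.coeff (n - (i : ℕ)) = constAnalytic (k (n - (i : ℕ))) * b i := fun i => by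
    rw [hp, finsetSum_coeff, Finset.sum_eq_single i]
    · rw [coeff_monomial, if_pos rfl]
    · intro i' _ hi'
      rw [coeff_monomial, if_neg]
      intro h
      have := i.is_le
      have := i'.is_le
      exact hi' (Fin.ext (by omega))
    · simp
  have hdeg : p.natDegree ≤ n := natDegree_sum_le_of_forall_le _ _ fun i _ =>
    (natDegree_monomial_le _).trans (Nat.sub_le _ _)
  have hcoeff0 : ∀ j, n < j → p.coeff j = 0 := natDegree_le_iff_coeff_eq_zero.1 hdeg
  have hn : (p.map residue).coeff n ≠ 0 := by
    have := hcoeff 0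
    rw [Fin.val_zero, Nat.sub_zero] at this
    rw [coeff_map, this, map_mul, residue_constAnalytic]
    exact mul_ne_zero (hk n) hb0
  have hdiv : X ^ (n - r : ℕ) ∣ p.map residue := by
    refine X_pow_dvd_iff.2 fun j hj => ?_
    have h1 := hcoeff ⟨n - j, by omega⟩
    rw [show n - (n - j) = j by omega] at h1
    rw [coeff_map, h1, map_mul, hb _ (Fin.lt_def.2 (by simp only; omega)), mul_zero]
  obtain ⟨χ, hχ⟩ := hdiv
  have hχne : χ ≠ 0 := by
    rintro rfl
    rw [hχ, mul_zero, coeff_zero] at hn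
    exact hn rfl
  refine ⟨p, χ, by omega, fun j => ?_, hχ, ?_, ?_, fun g => ?_⟩
  · rcases le_or_gt j n with hj | hj
    · have h1 := hcoeff ⟨n - j, by omega⟩
      rw [show n - (n - j) = j by omega] at h1
      rw [h1]
      exact mul_mem (constGerm_mem_K _ C) (hbK _)
    · rw [hcoeff0 j hj]
      exact zero_mem _
  · have h1 : (p.map residue).natDegree = n :=
      natDegree_eq_of_le_of_coeff_ne_zero (natDegree_map_le.trans hdeg) hn
    rw [hχ, natDegree_X_pow_mul _ hχne] at h1
    omega
  · have h1 := coeff_X_pow_mul χ (n - r : ℕ) 0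
    rw [zero_add, ← hχ, coeff_map, hcoeff r, map_mul, residue_constAnalytic] at h1
    rw [← h1]
    exact mul_ne_zero (hk _) hbr
  · rw [applyOp, hp, skewEval_sum, Finset.mul_sum]
    refine Finset.sum_congr rfl fun i _ => ?_
    -- The exponents `d + μ i` from `a_i` and `μ (n - i)` from the gauge factor add up to `d + μ n`
    -- for every `i`, so one common power of `z` factors out.
    have h1 : zmon (d + μ * n) = zmon (d + μ * (i : ℕ)) * zmon (μ * ((n - (i : ℕ) : ℕ) : ℤ)) := by
      rw [← zmon_add, Nat.cast_sub i.is_le]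
      congr 1
      ring
    rw [skewEval_monomial, iterate_map_mul, hkσ, hab, h1]
    push_cast
    rw [coe_constAnalytic]
    ring

end

end QDiff

theorem mainTheorem12 (q : ℂ) (hq : 1 < ‖q‖) (C : QDiff.ConvergentCase)
    (n : ℕ) (a : Fin (n + 1) → QDiff.OriginGerm) (haK : ∀ i, a i ∈ C.K)
    (ha_first : a 0 ≠ 0) (ha_last : a (Fin.last n) ≠ 0)
    (μ : ℤ) (hμ : IsLeast (QDiff.slopes a) (μ : ℚ)) :
    ∃ f : Fin (QDiff.newtonFunction a μ) → QDiff.OriginGerm,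
      (∀ i, f i ∈ C.L) ∧
      (∀ i, f i ∈ QDiff.convergentAlgebra q C) ∧
      (∀ i, QDiff.applyOp q hq a (f i) = 0) ∧
      LinearIndependent (QDiff.constants q hq C) f := by
  have haK' : ∀ i, a i ∈ QDiff.ConvergentCase.germ.K := fun i => C.K_le_germ_K (haK i)
  obtain ⟨d, r, hr, hd, hdr, hedge⟩ :=
    QDiff.exists_first_edge (QDiff.v₀_ne_top (haK' 0) ha_first) hμ.2
  choose b hab hb using fun i => QDiff.exists_eq_zmon_mul_of_le (haK' i) (hedge i).1
  obtain ⟨p, χ, hp, hpK, hpχ, hχ, hχ0, happly⟩ := QDiff.exists_gauge_transform hq haK hab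
    (fun h => ((hb 0).1 h).ne (by simp [hd])) (fun h => ((hb r).1 h).ne hdr.symm)
    (fun i hi => (hb i).2 ((hedge i).2 hi))
  rw [← hr]
  obtain ⟨f, hfV, hf, hind⟩ :=
    QDiff.exists_independent_solutions q hq C _ r p χ hp hpK hpχ hχ hχ0
  have hS := fun i => QDiff.thetaPow_mul_mem_convergentAlgebra μ (hfV i)
  refine ⟨fun i => QDiff.thetaPow q μ * f i, fun i => QDiff.convergentAlgebra_le_L hq C (hS i), hS,
    fun i => by rw [happly, hf, mul_zero], ?_⟩
  -- Multiplication by the unit `Θ_q^μ` is injective and linear over the constants, so it preserves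
  -- independence.
  exact hind.map' (LinearMap.mulLeft (QDiff.constants q hq C) (QDiff.thetaPow q μ))
    (LinearMap.ker_eq_bot.2 fun x y hxy => (QDiff.isUnit_thetaPow hq μ).mul_left_cancel hxy)
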